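/- Let $\kappa$ be an infinite regular cardinal; "$\kappa$-ary" means of size $<\kappa$. A *$\kappa$-Boolean algebra* is a Boolean algebra with $\kappa$-ary joins; homomorphisms are Boolean homomorphisms preserving $\kappa$-ary joins. The category $\kappa\mathsf{BorLoc}$ of *$\kappa$-Borel locales* is the opposite of the category of $\kappa$-Boolean algebras. A $\kappa$-Borel locale is *standard* if the dual algebra is $\kappa$-presented, i.e. has a presentation by $<\kappa$ generators and $<\kappa$ relations between $\kappa$-Boolean terms. An *image* of a morphism $f : X \to Y$ is an object $Z$ with a factorization of $f$ into a regular epimorphism $X \to Z$ followed by a monomorphism $Z \to Y$. A $\kappa$-Borel locale is *analytic* if it is the image in $\kappa\mathsf{BorLoc}$ of a morphism between standard $\kappa$-Borel locales. Let $\mathcal A \subseteq \kappa\mathsf{BorLoc}$ be the full subcategory of analytic $\kappa$-Borel locales. Then: (a) Limits of $\kappa$-ary diagrams, $\kappa$-ary coproducts, and images of morphisms between objects of $\mathcal A$ exist in $\kappa\mathsf{BorLoc}$, and $\mathcal A$ is closed under them; in particular, $\mathcal A$ has $\kappa$-ary limits. (b) $\mathcal A$ is *$\kappa$-extensive* (it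 has finite limits and pullback-stable $\kappa$-ary coproducts; coproduct injections are monic and pairwise disjoint; the initial object is strict) and *$\kappa$-coherent* (it is a regular category, and $\kappa$-ary families of subobjects have pullback-stable joins). (c) Let $I$ be a directed poset with $|I|<\kappa$, and let $(X_i)_{i \in I}$ be a codirected diagram in $\mathcal A$ with morphisms $f_{ij} : X_i \to X_j$ for $i \ge j$. If every $f_{ij}$ is an epimorphism (respectively, a regular epimorphism), then so is every limit projection $\varprojlim_j X_j \to X_i$. In particular, $\kappa$-ary products of epimorphisms in $\mathcal A$ are epimorphisms, and $\mathcal A$ is *$\kappa$-completely regular* (a regular category with $\kappa$-ary products, under which regular epimorphisms are closed). (d) For every $X \in \mathcal A$, the poset of subobjects of $X$ in $\mathcal A$ is a *$(\kappa,\kappa)$-frame*: it has $\kappa$-ary meets and $\kappa$-ary joins, finite joins distribute over $\kappa$-ary meets, and finite meets distribute over $\kappa$-ary joins. (e) Every epimorphism in $\mathcal A$ is regular. -/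

import Mathlib

open CategoryTheory CategoryTheory.Limits Opposite

universe u v w

/-- A `κ`-complete Boolean algebra: a Boolean algebra in which all subsets of size `< κ` have joins.
In a Boolean algebra finite meets distribute over all joins that exist, and joins of size `< κ` give
meets of size `< κ` by complementation, so nothing else has to be required. -/
structure KBoolAlg (κ : Cardinal.{u}) where
  carrier : Type u
  [str : BooleanAlgebra carrier]
  exists_isLUB : ∀ S : Set carrier, Cardinal.mk S < κ → ∃ s, IsLUB S s

namespace KBoolAlg

variable {κ : Cardinal.{u}}

instance : CoeSort (KBoolAlg κ) (Type u) := ⟨KBoolAlg.carrier⟩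

instance (A : KBoolAlg κ) : BooleanAlgebra A := A.str

/-- Homomorphisms of `κ`-Boolean algebras: Boolean homomorphisms that preserve joins of
size `< κ`. -/
@[ext]
structure Hom (A B : KBoolAlg κ) where
  toHom : BoundedLatticeHom A B
  map_isLUB : ∀ (S : Set A) (s : A), Cardinal.mk S < κ → IsLUB S s → IsLUB (toHom '' S) (toHom s)

instance : Category (KBoolAlg κ) where
  Hom := Hom
  id A :=
    { toHom := BoundedLatticeHom.id A
      map_isLUB := by
        intro S s _ hs
        have h : (BoundedLatticeHom.id A : A → A) '' S = S := by ext; simp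
        rw [h]
        exact hs }
  comp f g :=
    { toHom := g.toHom.comp f.toHom
      map_isLUB := by
        intro S s hS hs
        have h := g.map_isLUB _ _ (Cardinal.mk_image_le.trans_lt hS) (f.map_isLUB S s hS hs)
        have e : (g.toHom.comp f.toHom) '' S = g.toHom '' (f.toHom '' S) := by
          rw [Set.image_image]
          rfl
        rw [e]
        exact h }

/-- The join of a family of size `< κ`. -/
noncomputable def kSup (A : KBoolAlg κ) {I : Type u} (hI : Cardinal.mk I < κ) (a : I → A) : A :=
  (A.exists_isLUB (Set.range a) (Cardinal.mk_range_le.trans_lt hI)).choose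

theorem isLUB_kSup (A : KBoolAlg κ) {I : Type u} (hI : Cardinal.mk I < κ) (a : I → A) :
    IsLUB (Set.range a) (A.kSup hI a) :=
  (A.exists_isLUB (Set.range a) (Cardinal.mk_range_le.trans_lt hI)).choose_spec

end KBoolAlg

/-- Terms in the language of `κ`-Boolean algebras over a set `G` of generators; all other
operations are definable from complements and joins of size `< κ`. -/
inductive KBoolTerm (κ : Cardinal.{u}) (G : Type u) : Type (u + 1)
  | var (g : G) : KBoolTerm κ G
  | compl (t : KBoolTerm κ G) : KBoolTerm κ G
  | sup (I : Type u) (hI : Cardinal.mk I < κ) (t : I → KBoolTerm κ G) : KBoolTerm κ G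

/-- The value of a term in a `κ`-Boolean algebra under an assignment of the generators. -/
noncomputable def KBoolTerm.eval {κ : Cardinal.{u}} {G : Type u} (A : KBoolAlg κ) (f : G → A) :
    KBoolTerm κ G → A
  | .var g => f g
  | .compl t => (KBoolTerm.eval A f t)ᶜ
  | .sup _ hI t => A.kSup hI (fun i => KBoolTerm.eval A f (t i))

/-- `A` is presented by the generators `η : G → A` and the relations `l r = l' r`, `r : R`: the
relations hold in `A`, and `A` is universal with this property. -/
structure KBoolAlg.IsPresentedBy {κ : Cardinal.{u}} (A : KBoolAlg κ) {G R : Type u}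
    (l l' : R → KBoolTerm κ G) (η : G → A) : Prop where
  relations : ∀ r, (l r).eval A η = (l' r).eval A η
  universal : ∀ (B : KBoolAlg κ) (f : G → B), (∀ r, (l r).eval B f = (l' r).eval B f) →
    ∃! h : A ⟶ B, ∀ g, h.toHom (η g) = f g

/-- `A` is `κ`-presented: it has a presentation with `< κ` generators and `< κ` relations. -/
def KBoolAlg.IsKPresented {κ : Cardinal.{u}} (A : KBoolAlg κ) : Prop :=
  ∃ (G R : Type u) (l l' : R → KBoolTerm κ G) (η : G → A),
    Cardinal.mk G < κ ∧ Cardinal.mk R < κ ∧ A.IsPresentedBy l l' η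

/-- The category of `κ`-Borel locales, the dual of the category of `κ`-Boolean algebras. -/
abbrev KBorLoc (κ : Cardinal.{u}) : Type (u + 1) := (KBoolAlg κ)ᵒᵖ

/-- Standard `κ`-Borel locales: those whose dual algebra is `κ`-presented. -/
def KBorLoc.IsStandard {κ : Cardinal.{u}} (X : KBorLoc κ) : Prop := X.unop.IsKPresented

/-- `e` followed by `m` is an image factorization of `f`: a regular epimorphism followed by a
monomorphism. -/
structure IsImageFactorization {C : Type v} [Category.{w} C] {X Z Y : C}
    (f : X ⟶ Y) (e : X ⟶ Z) (m : Z ⟶ Y) : Prop where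
  fac : e ≫ m = f
  isRegularEpi : IsRegularEpi e
  mono : Mono m

/-- Analytic `κ`-Borel locales: the images, in the category of `κ`-Borel locales, of morphisms
between standard ones. -/
def KBorLoc.IsAnalytic (κ : Cardinal.{u}) : ObjectProperty (KBorLoc κ) := fun X =>
  ∃ (X₀ X₁ : KBorLoc κ) (p : X₀ ⟶ X₁) (e : X₀ ⟶ X) (m : X ⟶ X₁),
    X₀.IsStandard ∧ X₁.IsStandard ∧ IsImageFactorization p e m

/-- The full subcategory of analytic `κ`-Borel locales. -/
abbrev AnalyticKBorLoc (κ : Cardinal.{u}) : Type (u + 1) := (KBorLoc.IsAnalytic κ).FullSubcategory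

/-- `κ`-extensive categories: finite limits, and coproducts of size `< κ` that are pullback-stable
and disjoint, with a strict initial object. -/
structure IsKExtensive (κ : Cardinal.{u}) (C : Type v) [Category.{w} C] : Prop where
  hasFiniteLimits : HasFiniteLimits C
  hasCoproducts : ∀ I : Type u, Cardinal.mk I < κ → HasColimitsOfShape (Discrete I) C
  universal : ∀ I : Type u, Cardinal.mk I < κ → ∀ (X : I → C) (c : Cofan X),
    IsColimit c → IsUniversalColimit c
  disjoint : ∀ I : Type u, Cardinal.mk I < κ → ∀ X : I → C, CoproductDisjoint X
  strictInitial : HasStrictInitialObjects C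

/-- `κ`-coherent categories: regular categories with pullback-stable joins of `< κ` subobjects. -/
structure IsKCoherent (κ : Cardinal.{u}) (C : Type v) [Category.{w} C] : Prop extends
    Regular C where
  exists_join : ∀ (X : C) (I : Type u), Cardinal.mk I < κ → ∀ A : I → Subobject X,
    ∃ S : Subobject X, IsLUB (Set.range A) S ∧ ∀ (Y : C) (f : Y ⟶ X),
      IsLUB (Set.range fun i => (Subobject.pullback f).obj (A i)) ((Subobject.pullback f).obj S)

/-- Products of `< κ` morphisms in `W` are in `W`. -/
def IsStableUnderKProducts (κ : Cardinal.{u}) {C : Type v} [Category.{w} C]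
    (W : MorphismProperty C) : Prop :=
  ∀ I : Type u, Cardinal.mk I < κ → ∀ (X Y : I → C) (f : ∀ i, X i ⟶ Y i), (∀ i, W (f i)) →
    ∀ (c : Fan X) (d : Fan Y), IsLimit c → IsLimit d →
      ∀ g : c.pt ⟶ d.pt, (∀ i, g ≫ d.proj i = c.proj i ≫ f i) → W g

/-- `κ`-completely regular categories: regular categories with products of size `< κ`, under which
regular epimorphisms are closed. -/
structure IsKCompletelyRegular (κ : Cardinal.{u}) (C : Type v) [Category.{w} C] : Prop extends
    Regular C where
  hasProducts : ∀ I : Type u, Cardinal.mk I < κ → HasLimitsOfShape (Discrete I) C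
  regularEpi_products : IsStableUnderKProducts κ (MorphismProperty.regularEpi C)

/-- For each codirected diagram in `C` of size `< κ`, indexed by a directed poset, with all
transition morphisms in `W`, the limit projections are in `W`. -/
def IsStableUnderKCodirectedLimits (κ : Cardinal.{u}) {C : Type v} [Category.{w} C]
    (W : MorphismProperty C) : Prop :=
  ∀ (I : Type u) [PartialOrder I] [IsDirectedOrder I], Cardinal.mk I < κ → ∀ F : Iᵒᵖ ⥤ C,
    (∀ ⦃i j : Iᵒᵖ⦄ (f : i ⟶ j), W (F.map f)) →
      ∀ c : Cone F, IsLimit c → ∀ i, W (c.π.app i)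

/-- `(μ, κ)`-frames: posets with meets of size `< μ` and joins of size `< κ`, over which finite
joins, respectively finite meets, distribute. -/
structure IsKFrame (μ κ : Cardinal.{u}) (P : Type v) [PartialOrder P] : Prop where
  exists_inf : ∀ I : Type u, Cardinal.mk I < μ → ∀ b : I → P, ∃ s, IsGLB (Set.range b) s
  exists_sup : ∀ I : Type u, Cardinal.mk I < κ → ∀ b : I → P, ∃ s, IsLUB (Set.range b) s
  sup_inf_distrib : ∀ I : Type u, Cardinal.mk I < μ → ∀ (a : P) (b c : I → P) (s t : P),
    IsGLB (Set.range b) s → IsLUB {a, s} t → (∀ i, IsLUB {a, b i} (c i)) → IsGLB (Set.range c) t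
  inf_sup_distrib : ∀ I : Type u, Cardinal.mk I < κ → ∀ (a : P) (b c : I → P) (s t : P),
    IsLUB (Set.range b) s → IsGLB {a, s} t → (∀ i, IsGLB {a, b i} (c i)) → IsLUB (Set.range c) t

/-! Everything is computed in the dual category of algebras, where limits become colimits,
monomorphisms become surjections and epimorphisms become injections. A locale is analytic exactly
when its algebra has fewer than `κ` generators and embeds in a `κ`-presented algebra
(`isAnalytic_iff`).

The engine is an interpolation theorem, `exists_amalgam`. Spans `B i ← A i → C` have a common cocone
`D` in which the images of `c` and of elements `b i` have meet zero only for a visible reason: there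
are `a i` with `b i ≤ f i (a i)` such that `c` and the `g i (a i)` already have meet zero in `C`.
The algebra `D` is built by forcing. Conditions are formal meets `(c, b)`; those with such a witness
are declared zero, and `D` consists of the regular lower sets of the others. The maps into `D` are
homomorphisms because the zero conditions absorb joins of size `< κ` in each coordinate
(`exists_hom_of_meets`).

If the `f i` are injective, taking `b i = ⊤` shows that `C` embeds in `D`. Hence epimorphisms are
stable under pullbacks and products, and small limits of analytic locales are analytic. For a single
span the theorem is Craig interpolation (`exists_binary_amalgam`): it shows that monomorphisms have
surjective duals and that a morphism with injective dual is the coequalizer of its kernel pair, so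
epimorphisms are regular. Codirected limits need a second forcing, with the nonzero elements of a
directed diagram as conditions (`exists_directed_amalgam`).

A coproduct is a product of algebras, that is, an algebra with a partition of unity; pulling
partitions back gives extensivity. A subobject is determined by the ideal of elements vanishing on
it. Joins of subobjects are intersections of ideals, and by interpolation their meets are the ideals
generated by joins of elements, so the frame laws become short computations. -/

namespace KBoolAlg

variable {κ : Cardinal.{u}}

/-! ### Joins, meets and homomorphisms of `κ`-Boolean algebras -/

instance {A B : KBoolAlg κ} : FunLike (A ⟶ B) A B where
  coe f := f.toHom
  coe_injective f g h := by
    apply KBoolAlg.Hom.ext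
    exact DFunLike.coe_injective h

instance {A B : KBoolAlg κ} : BoundedLatticeHomClass (A ⟶ B) A B where
  map_sup f := f.toHom.map_sup'
  map_inf f := f.toHom.map_inf'
  map_top f := f.toHom.map_top'
  map_bot f := f.toHom.map_bot'

theorem toHom_apply {A B : KBoolAlg κ} (f : A ⟶ B) (x : A) : f.toHom x = f x := rfl

@[simp] theorem id_apply {A : KBoolAlg κ} (x : A) : (𝟙 A : A ⟶ A) x = x := rfl

@[simp] theorem comp_apply {A B C : KBoolAlg κ} (f : A ⟶ B) (g : B ⟶ C) (x : A) :
    (f ≫ g) x = g (f x) := rfl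

theorem hom_ext {A B : KBoolAlg κ} {f g : A ⟶ B} (h : ∀ x, f x = g x) : f = g :=
  DFunLike.ext _ _ h

theorem le_kSup {A : KBoolAlg κ} {I : Type u} (hI : Cardinal.mk I < κ) (a : I → A) (i : I) :
    a i ≤ A.kSup hI a :=
  (A.isLUB_kSup hI a).1 ⟨i, rfl⟩

theorem kSup_le {A : KBoolAlg κ} {I : Type u} (hI : Cardinal.mk I < κ) {a : I → A} {x : A}
    (h : ∀ i, a i ≤ x) : A.kSup hI a ≤ x :=
  (A.isLUB_kSup hI a).2 (by rintro _ ⟨i, rfl⟩; exact h i)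

theorem isLUB_range_map {A B : KBoolAlg κ} (f : A ⟶ B) {I : Type u} (hI : Cardinal.mk I < κ)
    {a : I → A} {s : A} (h : IsLUB (Set.range a) s) :
    IsLUB (Set.range fun i => f (a i)) (f s) := by
  have := f.map_isLUB _ s (Cardinal.mk_range_le.trans_lt hI) h
  rwa [← Set.range_comp] at this

theorem map_kSup {A B : KBoolAlg κ} (f : A ⟶ B) {I : Type u} (hI : Cardinal.mk I < κ)
    (a : I → A) : f (A.kSup hI a) = B.kSup hI fun i => f (a i) :=
  (isLUB_range_map f hI (A.isLUB_kSup hI a)).unique (B.isLUB_kSup hI _)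

theorem isGLB_range_compl {A : Type v} [BooleanAlgebra A] {I : Type w} {a : I → A} {s : A} :
    IsGLB (Set.range fun i => (a i)ᶜ) sᶜ ↔ IsLUB (Set.range a) s := by
  constructor
  · intro h
    refine ⟨?_, fun x hx => ?_⟩
    · rintro _ ⟨i, rfl⟩
      exact compl_le_compl_iff_le.1 (h.1 ⟨i, rfl⟩)
    · refine compl_le_compl_iff_le.1 (h.2 ?_)
      rintro _ ⟨i, rfl⟩
      exact compl_le_compl (hx ⟨i, rfl⟩)
  · intro h
    refine ⟨?_, fun x hx => ?_⟩
    · rintro _ ⟨i, rfl⟩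
      exact compl_le_compl (h.1 ⟨i, rfl⟩)
    · refine le_compl_comm.1 (h.2 ?_)
      rintro _ ⟨i, rfl⟩
      exact le_compl_comm.1 (hx ⟨i, rfl⟩)

theorem isLUB_range_compl {A : Type v} [BooleanAlgebra A] {I : Type w} {a : I → A} {s : A} :
    IsLUB (Set.range fun i => (a i)ᶜ) sᶜ ↔ IsGLB (Set.range a) s := by
  rw [← isGLB_range_compl]; simp

/-- The meet of a family of size `< κ`. -/
noncomputable def kInf (A : KBoolAlg κ) {I : Type u} (hI : Cardinal.mk I < κ) (a : I → A) : A :=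
  (A.kSup hI fun i => (a i)ᶜ)ᶜ

theorem isGLB_kInf (A : KBoolAlg κ) {I : Type u} (hI : Cardinal.mk I < κ) (a : I → A) :
    IsGLB (Set.range a) (A.kInf hI a) := by
  have := isGLB_range_compl.2 (A.isLUB_kSup hI fun i => (a i)ᶜ)
  simpa [kInf] using this

theorem kInf_le {A : KBoolAlg κ} {I : Type u} (hI : Cardinal.mk I < κ) (a : I → A) (i : I) :
    A.kInf hI a ≤ a i :=
  (A.isGLB_kInf hI a).1 ⟨i, rfl⟩

theorem le_kInf {A : KBoolAlg κ} {I : Type u} (hI : Cardinal.mk I < κ) {a : I → A} {x : A}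
    (h : ∀ i, x ≤ a i) : x ≤ A.kInf hI a :=
  (A.isGLB_kInf hI a).2 (by rintro _ ⟨i, rfl⟩; exact h i)

theorem map_kInf {A B : KBoolAlg κ} (f : A ⟶ B) {I : Type u} (hI : Cardinal.mk I < κ)
    (a : I → A) : f (A.kInf hI a) = B.kInf hI fun i => f (a i) := by
  simp [kInf, map_kSup]

/-- Finite meets distribute over joins that exist in a Boolean algebra. -/
theorem inf_le_of_isLUB {A : Type v} [BooleanAlgebra A] {I : Type w} {a : I → A} {s x y : A}
    (hs : IsLUB (Set.range a) s) (h : ∀ i, x ⊓ a i ≤ y) : x ⊓ s ≤ y := by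
  rw [inf_comm, ← le_himp_iff]
  refine hs.2 ?_
  rintro _ ⟨i, rfl⟩
  rw [le_himp_iff, inf_comm]
  exact h i

theorem inf_kSup_le {A : KBoolAlg κ} {I : Type u} (hI : Cardinal.mk I < κ) {a : I → A} {x y : A}
    (h : ∀ i, x ⊓ a i ≤ y) : x ⊓ A.kSup hI a ≤ y :=
  inf_le_of_isLUB (A.isLUB_kSup hI a) h

theorem injective_iff {A B : KBoolAlg κ} (f : A ⟶ B) :
    Function.Injective f ↔ ∀ x, f x = ⊥ → x = ⊥ := by
  refine ⟨fun h x hx => h (hx.trans (map_bot f).symm), fun h x y hxy => ?_⟩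
  have key : ∀ x y, f x = f y → x ≤ y := fun x y hxy => by
    rw [← sdiff_eq_bot_iff]
    apply h
    rw [map_sdiff', hxy, sdiff_self]
  exact le_antisymm (key _ _ hxy) (key _ _ hxy.symm)

theorem le_iff_of_injective {A B : KBoolAlg κ} {f : A ⟶ B} (hf : Function.Injective f) {x y : A} :
    f x ≤ f y ↔ x ≤ y := by
  rw [← sdiff_eq_bot_iff, ← map_sdiff', ← sdiff_eq_bot_iff]
  exact ⟨(injective_iff f).1 hf _, fun h => by rw [h, map_bot]⟩

section Regular

theorem mk_ulift_bool_lt [hκ : Fact κ.IsRegular] : Cardinal.mk (ULift.{u} Bool) < κ :=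
  (Cardinal.lt_aleph0_of_finite _).trans_le hκ.out.aleph0_le

theorem mk_punit_lt [hκ : Fact κ.IsRegular] : Cardinal.mk PUnit.{u + 1} < κ :=
  (Cardinal.lt_aleph0_of_finite _).trans_le hκ.out.aleph0_le

theorem mk_pempty_lt [hκ : Fact κ.IsRegular] : Cardinal.mk PEmpty.{u + 1} < κ :=
  (Cardinal.lt_aleph0_of_finite _).trans_le hκ.out.aleph0_le

theorem mk_sigma_lt [hκ : Fact κ.IsRegular] {I : Type u} (hI : Cardinal.mk I < κ) {G : I → Type u}
    (hG : ∀ i, Cardinal.mk (G i) < κ) : Cardinal.mk (Σ i, G i) < κ := by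
  rw [Cardinal.mk_sigma]
  exact Cardinal.sum_lt_of_isRegular hκ.out hI hG

theorem mk_sum_lt [hκ : Fact κ.IsRegular] {G R : Type u} (hG : Cardinal.mk G < κ)
    (hR : Cardinal.mk R < κ) :
    Cardinal.mk (G ⊕ R) < κ := by
  rw [Cardinal.mk_sum, Cardinal.lift_id, Cardinal.lift_id]
  exact Cardinal.add_lt_of_lt hκ.out.aleph0_le hG hR

theorem range_ulift_bool {A : Type v} (x y : A) :
    (Set.range fun b : ULift.{u} Bool => cond b.down x y) = {x, y} := by
  ext z
  simp [eq_comm, or_comm]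

variable [Fact κ.IsRegular]

/-- A map that preserves complements and joins of size `< κ` is a homomorphism. -/
def homOfSup {A B : KBoolAlg κ} (f : A → B) (hc : ∀ a, f aᶜ = (f a)ᶜ)
    (hs : ∀ (I : Type u), Cardinal.mk I < κ → ∀ (a : I → A) (s : A), IsLUB (Set.range a) s →
      IsLUB (Set.range fun i => f (a i)) (f s)) : A ⟶ B :=
  have hsup : ∀ x y, f (x ⊔ y) = f x ⊔ f y := fun x y => by
    have := hs (ULift Bool) mk_ulift_bool_lt (fun b => cond b.down x y) (x ⊔ y)
      (by rw [range_ulift_bool]; exact isLUB_pair)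
    have e : (fun b : ULift.{u} Bool => f (cond b.down x y)) =
      fun b => cond b.down (f x) (f y) := by
      funext ⟨b⟩
      cases b <;> rfl
    rw [e, range_ulift_bool] at this
    exact this.unique isLUB_pair
  have hbot : f ⊥ = ⊥ := by
    have := hs PEmpty mk_pempty_lt PEmpty.elim ⊥ (by rw [Set.range_eq_empty]; exact isLUB_empty)
    rw [Set.range_eq_empty] at this
    exact this.unique isLUB_empty
  { toHom :=
    { toFun := f
      map_sup' := hsup
      map_inf' := fun x y => by
        rw [← compl_inj_iff, compl_inf, ← hc, ← hc, ← hc, compl_inf, hsup]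
      map_top' := by
        change f ⊤ = ⊤
        rw [← compl_bot, hc, hbot, compl_bot]
      map_bot' := hbot }
    map_isLUB := fun S s hS h => by
      have := hs S hS Subtype.val s (by simpa using h)
      rw [show (fun i : S => f i) = f ∘ Subtype.val from rfl, Set.range_comp,
        Subtype.range_coe] at this
      exact this }

theorem isIso_of_bijective {A B : KBoolAlg κ} (f : A ⟶ B) (hf : Function.Bijective f) :
    IsIso f := by
  let e := Equiv.ofBijective f hf
  have he : ∀ x, f (e.symm x) = x := e.apply_symm_apply
  refine ⟨homOfSup e.symm (fun a => ?_) (fun I hI a s h => ?_), ?_, ?_⟩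
  · apply hf.1
    rw [he, map_compl', he]
  · rw [← he s] at h
    refine ⟨?_, fun x hx => ?_⟩
    · rintro _ ⟨i, rfl⟩
      rw [← le_iff_of_injective hf.1, he]
      rw [he s] at h ⊢
      exact h.1 ⟨i, rfl⟩
    · rw [← le_iff_of_injective hf.1]
      refine h.2 ?_
      rintro _ ⟨i, rfl⟩
      rw [← he (a i), le_iff_of_injective hf.1]
      exact hx ⟨i, rfl⟩
  · exact hom_ext fun x => e.symm_apply_apply x
  · exact hom_ext fun x => he x

/-- A homomorphism factors through each surjection whose kernel it kills. -/
theorem exists_factor_of_surjective {A B C : KBoolAlg κ} (f : A ⟶ B)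
    (hf : Function.Surjective f) (g : A ⟶ C) (h : ∀ x, f x = ⊥ → g x = ⊥) :
    ∃ k : B ⟶ C, f ≫ k = g := by
  have hle : ∀ x y, f x ≤ f y → g x ≤ g y := fun x y hxy => by
    rw [← sdiff_eq_bot_iff, ← map_sdiff'] at hxy ⊢
    exact h _ hxy
  have heq : ∀ x y, f x = f y → g x = g y := fun x y hxy =>
    le_antisymm (hle _ _ hxy.le) (hle _ _ hxy.ge)
  choose r hr using hf
  have hgr : ∀ x, g (r (f x)) = g x := fun x => heq _ _ (hr _)
  refine ⟨homOfSup (fun b => g (r b)) (fun b => ?_) (fun I hI a s hs => ?_), hom_ext hgr⟩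
  · rw [← map_compl']
    apply heq
    rw [map_compl', hr, hr]
  · have e : g (r s) = g (A.kSup hI fun i => r (a i)) := by
      apply heq
      rw [map_kSup, hr]
      simp only [hr]
      exact hs.unique (B.isLUB_kSup hI a)
    rw [e]
    exact isLUB_range_map g hI (A.isLUB_kSup hI _)

/-- A homomorphism factors through each injection whose range contains its own. -/
theorem exists_factor_of_injective {A B C : KBoolAlg κ} (f : B ⟶ C)
    (hf : Function.Injective f) (g : A ⟶ C) (h : ∀ x, ∃ y, f y = g x) :
    ∃ k : A ⟶ B, k ≫ f = g := by
  choose k hk using h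
  refine ⟨homOfSup k (fun a => ?_) (fun I hI a s hs => ?_), hom_ext hk⟩
  · apply hf
    rw [hk, map_compl', map_compl', hk]
  · have := isLUB_range_map g hI hs
    refine ⟨?_, fun x hx => ?_⟩
    · rintro _ ⟨i, rfl⟩
      rw [← le_iff_of_injective hf, hk, hk]
      exact this.1 ⟨i, rfl⟩
    · rw [← le_iff_of_injective hf, hk]
      refine this.2 ?_
      rintro _ ⟨i, rfl⟩
      dsimp only
      rw [← hk, le_iff_of_injective hf]
      exact hx ⟨i, rfl⟩

end Regular

end KBoolAlg

/-! ### Terms, generated subalgebras, presentations and products -/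

open KBoolAlg

theorem KBoolTerm.map_eval {κ : Cardinal.{u}} {G : Type u} {A B : KBoolAlg κ} (f : A ⟶ B)
    (a : G → A) (t : KBoolTerm κ G) : f (t.eval A a) = t.eval B fun g => f (a g) := by
  induction t with
  | var g => rfl
  | compl t ih => simp only [eval, map_compl', ih]
  | sup I hI t ih => simp only [eval, map_kSup, ih]

/-- Substitution of variables. -/
def KBoolTerm.rename {κ : Cardinal.{u}} {G H : Type u} (r : G → H) : KBoolTerm κ G → KBoolTerm κ H
  | .var g => .var (r g)
  | .compl t => .compl (t.rename r)
  | .sup I hI t => .sup I hI fun i => (t i).rename r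

theorem KBoolTerm.eval_rename {κ : Cardinal.{u}} {G H : Type u} (r : G → H) (A : KBoolAlg κ)
    (a : H → A) (t : KBoolTerm κ G) : (t.rename r).eval A a = t.eval A fun g => a (r g) := by
  induction t with
  | var g => rfl
  | compl t ih => simp only [rename, eval, ih]
  | sup I hI t ih => simp only [rename, eval, ih]

namespace KBoolAlg

variable {κ : Cardinal.{u}}

theorem isLUB_range_pi {I : Type u} {J : Type w} {A : I → Type v} [∀ i, Preorder (A i)]
    {a : J → ∀ i, A i} {s : ∀ i, A i} :
    IsLUB (Set.range a) s ↔ ∀ i, IsLUB (Set.range fun j => a j i) (s i) := by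
  rw [isLUB_pi]
  refine forall_congr' fun i => ?_
  rw [← Set.range_comp]
  rfl

/-- The elements `η g` generate `A`: each element is the value of a term. -/
def IsGenBy (A : KBoolAlg κ) {G : Type u} (η : G → A) : Prop :=
  ∀ x : A, ∃ t : KBoolTerm κ G, t.eval A η = x

theorem IsGenBy.hom_ext {A B : KBoolAlg κ} {G : Type u} {η : G → A} (hη : A.IsGenBy η)
    {f g : A ⟶ B} (h : ∀ x, f (η x) = g (η x)) : f = g := by
  refine KBoolAlg.hom_ext fun x => ?_
  obtain ⟨t, rfl⟩ := hη x
  simp only [KBoolTerm.map_eval, h]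

theorem IsPresentedBy.exists_hom {A : KBoolAlg κ} {G R : Type u} {l l' : R → KBoolTerm κ G}
    {η : G → A} (h : A.IsPresentedBy l l' η) {B : KBoolAlg κ} (f : G → B)
    (hf : ∀ r, (l r).eval B f = (l' r).eval B f) : ∃ k : A ⟶ B, ∀ g, k (η g) = f g := by
  obtain ⟨k, hk, -⟩ := h.universal B f hf
  exact ⟨k, hk⟩

variable [Fact κ.IsRegular]

/-- A small subset of a Boolean algebra that is closed under complements and under joins of
size `< κ` is the range of an injection of a `κ`-Boolean algebra. -/
theorem exists_of_closed {E : Type v} [BooleanAlgebra E] (L : Set E) [Small.{u} L]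
    (hc : ∀ x ∈ L, xᶜ ∈ L)
    (hs : ∀ I : Type u, Cardinal.mk I < κ → ∀ a : I → E, (∀ i, a i ∈ L) →
      ∃ s ∈ L, IsLUB (Set.range a) s) :
    ∃ (A : KBoolAlg κ) (j : A → E), Function.Injective j ∧ Set.range j = L ∧
      (∀ x, j xᶜ = (j x)ᶜ) ∧ ∀ I : Type u, Cardinal.mk I < κ → ∀ (a : I → A) (s : A),
        IsLUB (Set.range a) s ↔ IsLUB (Set.range fun i => j (a i)) (j s) := by
  have hsup : ∀ {x y}, x ∈ L → y ∈ L → x ⊔ y ∈ L := fun {x y} hx hy => by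
    obtain ⟨s, hsL, hs⟩ := hs (ULift Bool) mk_ulift_bool_lt (fun b => cond b.down x y)
      (by rintro ⟨_ | _⟩ <;> assumption)
    rw [range_ulift_bool] at hs
    rwa [isLUB_pair.unique hs]
  have hbot : ⊥ ∈ L := by
    obtain ⟨s, hsL, hs⟩ := hs PEmpty mk_pempty_lt PEmpty.elim (fun i => i.elim)
    rw [Set.range_eq_empty] at hs
    rwa [isLUB_empty.unique hs]
  let B : BooleanSubalgebra E :=
    { carrier := L
      supClosed' := fun x hx y hy => hsup hx hy
      infClosed' := fun x hx y hy => by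
        have := hc _ (hsup (hc x hx) (hc y hy))
        rwa [← compl_inf, compl_compl] at this
      compl_mem' := fun {x} hx => hc x hx
      bot_mem' := hbot }
  have : Small.{u} B := inferInstanceAs (Small.{u} L)
  let e : Shrink.{u} B ≃ B := (equivShrink B).symm
  let : BooleanAlgebra (Shrink.{u} B) := e.booleanAlgebra
  have hle : ∀ x y : Shrink.{u} B, x ≤ y ↔ (e x : E) ≤ e y := fun x y => Iff.rfl
  have key : ∀ {I : Type u} (a : I → Shrink.{u} B) (s : Shrink.{u} B), Cardinal.mk I < κ →
      (IsLUB (Set.range a) s ↔ IsLUB (Set.range fun i => (e (a i) : E)) (e s)) := by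
    intro I a s hI
    have back : ∀ s : Shrink.{u} B, IsLUB (Set.range fun i => (e (a i) : E)) (e s) →
        IsLUB (Set.range a) s := fun s h => by
      refine ⟨?_, fun x hx => ?_⟩
      · rintro _ ⟨i, rfl⟩
        exact (hle _ _).2 (h.1 ⟨i, rfl⟩)
      · refine (hle _ _).2 (h.2 ?_)
        rintro _ ⟨i, rfl⟩
        exact (hle _ _).1 (hx ⟨i, rfl⟩)
    refine ⟨fun h => ?_, back s⟩
    -- The join formed in `E` lies in `L`, so it is also the join in the subalgebra and must equal
    -- `s`.
    obtain ⟨t, htL, ht⟩ := hs I hI (fun i => (e (a i) : E)) fun i => (e (a i)).2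
    have het : ((e (e.symm ⟨t, htL⟩) : B) : E) = t := by rw [e.apply_symm_apply]
    rw [← het] at ht
    rwa [h.unique (back _ ht)]
  refine ⟨⟨Shrink.{u} B, fun S hS => ?_⟩, fun x => (e x : E), ?_, ?_, fun x => ?_,
    fun I hI a s => key a s hI⟩
  · obtain ⟨t, htL, ht⟩ := hs S hS (fun i => (e i : E)) fun i => (e i).2
    have het : ((e (e.symm ⟨t, htL⟩) : B) : E) = t := by rw [e.apply_symm_apply]
    rw [← het] at ht
    refine ⟨e.symm ⟨t, htL⟩, ?_⟩
    have := (key (fun i : S => (i : Shrink.{u} B)) (e.symm ⟨t, htL⟩) hS).2 ht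
    rwa [Subtype.range_coe] at this
  · exact Subtype.coe_injective.comp e.injective
  · ext x
    constructor
    · rintro ⟨y, rfl⟩
      exact (e y).2
    · intro hx
      exact ⟨e.symm ⟨x, hx⟩, by dsimp only; rw [e.apply_symm_apply]⟩
  · change ((e (e.symm (e x)ᶜ) : B) : E) = _
    rw [e.apply_symm_apply]
    rfl

/-- The image of a homomorphism. -/
theorem exists_image {A B : KBoolAlg κ} (f : A ⟶ B) :
    ∃ (C : KBoolAlg κ) (e : A ⟶ C) (m : C ⟶ B), e ≫ m = f ∧ Function.Surjective e ∧
      Function.Injective m := by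
  obtain ⟨C, j, hj, hr, hc, hs⟩ := exists_of_closed (κ := κ) (Set.range f)
    (by rintro _ ⟨x, rfl⟩; exact ⟨xᶜ, map_compl' f x⟩)
    (fun I hI a ha => by
      choose x hx using ha
      refine ⟨f (A.kSup hI x), ⟨_, rfl⟩, ?_⟩
      rw [map_kSup]
      simp only [hx]
      exact B.isLUB_kSup hI a)
  let m : C ⟶ B := homOfSup j hc fun I hI a s h => (hs I hI a s).1 h
  have hm : ∀ x, m x = j x := fun _ => rfl
  obtain ⟨e, he⟩ := exists_factor_of_injective m hj f fun x => by
    have : f x ∈ Set.range j := hr ▸ ⟨x, rfl⟩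
    exact this
  refine ⟨C, e, m, he, fun y => ?_, hj⟩
  have : j y ∈ Set.range f := hr ▸ ⟨y, rfl⟩
  obtain ⟨x, hx⟩ := this
  refine ⟨x, hj ?_⟩
  rw [← hm, ← hx, ← he]
  rfl

/-- The subalgebra generated by a family. -/
theorem exists_closure {A : KBoolAlg κ} {G : Type u} (η : G → A) :
    ∃ (C : KBoolAlg κ) (m : C ⟶ A), Function.Injective m ∧
      ∀ x, (∃ y, m y = x) ↔ ∃ t : KBoolTerm κ G, t.eval A η = x := by
  obtain ⟨C, j, hj, hr, hc, hs⟩ := exists_of_closed (κ := κ)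
    {x | ∃ t : KBoolTerm κ G, t.eval A η = x}
    (by rintro _ ⟨t, rfl⟩; exact ⟨t.compl, rfl⟩)
    (fun I hI a ha => by
      choose t ht using ha
      refine ⟨_, ⟨.sup I hI t, rfl⟩, ?_⟩
      simp only [KBoolTerm.eval, ht]
      exact A.isLUB_kSup hI a)
  exact ⟨C, homOfSup j hc fun I hI a s h => (hs I hI a s).1 h, hj, fun x => Set.ext_iff.1 hr x⟩

end KBoolAlg

/-- Codes for terms: arities are subsets of a fixed set of size `κ`, so that the codes form
a small type. -/
inductive KBoolCode (κ : Cardinal.{u}) (G : Type u) : Type u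
  | var (g : G) : KBoolCode κ G
  | compl (t : KBoolCode κ G) : KBoolCode κ G
  | sup (S : Set κ.out) (hS : Cardinal.mk S < κ) (t : S → KBoolCode κ G) : KBoolCode κ G

/-- The term with a given code. -/
def KBoolCode.toTerm {κ : Cardinal.{u}} {G : Type u} : KBoolCode κ G → KBoolTerm κ G
  | .var g => .var g
  | .compl t => .compl t.toTerm
  | .sup S hS t => .sup S hS fun i => (t i).toTerm

theorem KBoolCode.exists_eval_eq {κ : Cardinal.{u}} {G : Type u} (t : KBoolTerm κ G) :
    ∃ c : KBoolCode κ G, ∀ (A : KBoolAlg κ) (f : G → A), c.toTerm.eval A f = t.eval A f := by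
  induction t with
  | var g => exact ⟨.var g, fun _ _ => rfl⟩
  | compl t ih =>
    obtain ⟨c, hc⟩ := ih
    exact ⟨.compl c, fun A f => by simp only [toTerm, KBoolTerm.eval, hc]⟩
  | sup I hI t ih =>
    choose c hc using ih
    have hle : Cardinal.mk I ≤ Cardinal.mk κ.out := by rw [Cardinal.mk_out]; exact hI.le
    obtain ⟨e⟩ := hle
    let e' := Equiv.ofInjective e e.injective
    have hS : Cardinal.mk (Set.range e) < κ := by rwa [← Cardinal.mk_congr e']
    refine ⟨.sup (Set.range e) hS fun i => c (e'.symm i), fun A f => ?_⟩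
    simp only [toTerm, KBoolTerm.eval, hc]
    refine (A.isLUB_kSup hS _).unique ?_
    have := A.isLUB_kSup hI fun i => (t i).eval A f
    rwa [← e'.symm.surjective.range_comp] at this

namespace KBoolAlg

variable {κ : Cardinal.{u}} [Fact κ.IsRegular]

/-- For each class `P` of maps from `G` to `κ`-Boolean algebras there is an algebra generated
by `G` that maps compatibly to all of them and in which elements are equal when their images are. -/
theorem exists_generic (G : Type u) (P : ∀ B : KBoolAlg κ, (G → B) → Prop) :
    ∃ (A : KBoolAlg κ) (η : G → A), A.IsGenBy η ∧
      (∀ (B : KBoolAlg κ) (f : G → B), P B f → ∃ h : A ⟶ B, ∀ g, h (η g) = f g) ∧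
      ∀ x y : A, (∀ (B : KBoolAlg κ) (h : A ⟶ B), P B (fun g => h (η g)) → h x = h y) →
        x = y := by
  let M := { p : Σ B : KBoolAlg κ, G → B // P p.1 p.2 }
  let ev : KBoolTerm κ G → ∀ m : M, m.1.1 := fun t m => t.eval m.1.1 m.1.2
  -- The product over `M` may be large, but the values of terms in it form a small set, because
  -- codes already exhaust them.
  have hev : Set.range ev = Set.range fun c : KBoolCode κ G => ev c.toTerm := by
    ext x
    constructor
    · rintro ⟨t, rfl⟩
      obtain ⟨c, hc⟩ := KBoolCode.exists_eval_eq t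
      exact ⟨c, funext fun m => hc _ _⟩
    · rintro ⟨c, rfl⟩
      exact ⟨_, rfl⟩
  have : Small.{u} (Set.range ev) := by rw [hev]; infer_instance
  obtain ⟨A, j, hj, hr, hc, hs⟩ := exists_of_closed (κ := κ) (Set.range ev)
    (by rintro _ ⟨t, rfl⟩; exact ⟨t.compl, rfl⟩)
    (fun I hI a ha => by
      choose t ht using ha
      refine ⟨_, ⟨.sup I hI t, rfl⟩, isLUB_range_pi.2 fun m => ?_⟩
      have := m.1.1.isLUB_kSup hI fun i => (t i).eval m.1.1 m.1.2
      simp only [← ht]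
      exact this)
  have hvar : ∀ g, ev (.var g) ∈ Set.range j := fun g => hr ▸ ⟨_, rfl⟩
  choose η hη using hvar
  let π : ∀ m : M, A ⟶ m.1.1 := fun m => homOfSup (fun x => j x m) (fun x => by rw [hc]; rfl)
    fun I hI a s h => by
      exact isLUB_range_pi.1 ((hs I hI a s).1 h) m
  have hπ : ∀ m g, π m (η g) = m.1.2 g := fun m g => congrFun (hη g) m
  refine ⟨A, η, fun x => ?_, fun B f hf => ⟨π ⟨⟨B, f⟩, hf⟩, hπ _⟩, fun x y h => hj ?_⟩
  · have : j x ∈ Set.range ev := hr ▸ ⟨x, rfl⟩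
    obtain ⟨t, ht⟩ := this
    refine ⟨t, hj ?_⟩
    rw [← ht]
    funext m
    have := KBoolTerm.map_eval (π m) η t
    simp only [hπ] at this
    exact this
  · funext m
    exact h _ (π m) (by simp only [hπ]; exact m.2)

/-- Equality in the generic algebra for the class of all solutions of the relations is tested on
solutions, so the relations hold in it. -/
theorem exists_isPresentedBy {G R : Type u} (l l' : R → KBoolTerm κ G) :
    ∃ (A : KBoolAlg κ) (η : G → A), A.IsPresentedBy l l' η ∧ A.IsGenBy η := by
  obtain ⟨A, η, hη, hu, hj⟩ := exists_generic (κ := κ) G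
    fun B f => ∀ r, (l r).eval B f = (l' r).eval B f
  refine ⟨A, η, ⟨fun r => hj _ _ fun B h hB => ?_, fun B f hf => ?_⟩, hη⟩
  · rw [KBoolTerm.map_eval, KBoolTerm.map_eval, hB]
  · obtain ⟨h, hh⟩ := hu B f hf
    exact ⟨h, hh, fun h' hh' => hη.hom_ext fun g => (hh' g).trans (hh g).symm⟩

/-- The subalgebra generated by `η` also satisfies the relations, so universality splits its
inclusion, which is therefore onto. -/
theorem IsPresentedBy.isGenBy {A : KBoolAlg κ} {G R : Type u} {l l' : R → KBoolTerm κ G}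
    {η : G → A} (h : A.IsPresentedBy l l' η) : A.IsGenBy η := by
  obtain ⟨C, m, hm, hC⟩ := exists_closure η
  have hg : ∀ g, ∃ y, m y = η g := fun g => (hC _).2 ⟨.var g, rfl⟩
  choose c hc using hg
  obtain ⟨k, hk, -⟩ := h.universal C c fun r => hm (by
    simp only [KBoolTerm.map_eval, hc]
    exact h.relations r)
  have hid : k ≫ m = 𝟙 A := by
    refine (h.universal A η h.relations).unique (fun g => ?_) fun g => rfl
    rw [toHom_apply] at *
    simp only [toHom_apply] at hk
    rw [comp_apply, hk, hc]
  intro x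
  refine (hC x).1 ⟨k x, ?_⟩
  rw [← comp_apply, hid, id_apply]

/-- The product of a family of `κ`-Boolean algebras. -/
def pi {I : Type u} (A : I → KBoolAlg κ) : KBoolAlg κ where
  carrier := ∀ i, A i
  exists_isLUB S hS := by
    refine ⟨fun i => (A i).kSup hS fun x => x.1 i, isLUB_pi.2 fun i => ?_⟩
    have := (A i).isLUB_kSup hS fun x => x.1 i
    rwa [Set.image_eq_range]

/-- The projections from the product. -/
def piProj {I : Type u} (A : I → KBoolAlg κ) (i : I) : pi A ⟶ A i :=
  homOfSup (fun x => x i) (fun _ => rfl) fun J _ a s h => by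
    exact isLUB_range_pi.1 h i

/-- The homomorphism into the product with given components. -/
def piLift {I : Type u} {A : I → KBoolAlg κ} {B : KBoolAlg κ} (f : ∀ i, B ⟶ A i) : B ⟶ pi A :=
  homOfSup (fun x i => f i x) (fun x => funext fun i => map_compl' (f i) x)
    fun J hJ a s h => by
      exact isLUB_range_pi.2 fun i => isLUB_range_map (f i) hJ h

theorem piLift_apply {I : Type u} {A : I → KBoolAlg κ} {B : KBoolAlg κ} (f : ∀ i, B ⟶ A i)
    (x : B) (i : I) : piLift f x i = f i x := rfl

end KBoolAlg

/-! ### Forcing: regular lower sets and amalgamation -/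

namespace KBoolAlg

variable {κ : Cardinal.{u}}

theorem mem_lowerSet_compl {P : Type u} [Preorder P] {s : LowerSet P} {p : P} :
    p ∈ sᶜ ↔ ∀ q ≤ p, q ∉ s := by
  rw [← LowerSet.Iic_le, le_compl_iff_disjoint_right, disjoint_iff_inf_le]
  constructor
  · intro h q hq hs
    exact h (show q ∈ LowerSet.Iic p ⊓ s from ⟨hq, hs⟩)
  · rintro h q ⟨hq, hs⟩
    exact h q hq hs

/-- The algebra of regular lower sets of a preorder. -/
def regularLowerSets (κ : Cardinal.{u}) (P : Type u) [Preorder P] : KBoolAlg κ where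
  carrier := Heyting.Regular (LowerSet P)
  exists_isLUB S _ := by
    have h := Heyting.Regular.gi.gc.isLUB_l_image
      (isLUB_sSup ((fun x : Heyting.Regular (LowerSet P) => (x : LowerSet P)) '' S))
    rw [Set.image_image] at h
    simp only [Heyting.Regular.toRegular_coe, Set.image_id'] at h
    exact ⟨_, h⟩

/-- The regular lower set given by a lower set that is a pseudocomplement. -/
def regularLowerSets.mk {P : Type u} [Preorder P] (s t : LowerSet P)
    (h : ∀ p, p ∈ s ↔ ∀ q ≤ p, q ∉ t) : regularLowerSets κ P :=
  (⟨s, by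
    have : s = tᶜ := by
      ext p
      rw [SetLike.mem_coe, SetLike.mem_coe, mem_lowerSet_compl, h]
    rw [this]
    exact Heyting.isRegular_compl t⟩ : Heyting.Regular (LowerSet P))

/-- The underlying lower set. -/
def regularLowerSets.toLowerSet {P : Type u} [Preorder P] (x : regularLowerSets κ P) :
    LowerSet P :=
  Heyting.Regular.val x

theorem regularLowerSets_compl_mk {P : Type u} [Preorder P] {s t : LowerSet P} {h h'} :
    (regularLowerSets.mk s t h : regularLowerSets κ P)ᶜ = regularLowerSets.mk t s h' := by
  refine Heyting.Regular.coe_injective (?_ : sᶜ = t)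
  ext p
  rw [SetLike.mem_coe, mem_lowerSet_compl]
  exact (h' p).symm

/-- Regular lower sets are ordered by inclusion, so a value that is an intersection is automatically
the meet; joins then follow by complementation. -/
theorem exists_hom_regularLowerSets [Fact κ.IsRegular] {B : KBoolAlg κ} {P : Type u} [Preorder P]
    (U : B → LowerSet P) (hc : ∀ b p, p ∈ U bᶜ ↔ ∀ q ≤ p, q ∉ U b)
    (hi : ∀ I : Type u, Cardinal.mk I < κ → ∀ (a : I → B) (s : B), IsGLB (Set.range a) s →
      ∀ p, p ∈ U s ↔ ∀ i, p ∈ U (a i)) :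
    ∃ f : B ⟶ regularLowerSets κ P, ∀ b, regularLowerSets.toLowerSet (f b) = U b := by
  have hc' : ∀ b p, p ∈ U b ↔ ∀ q ≤ p, q ∉ U bᶜ := fun b p => by
    have := hc bᶜ p
    rwa [compl_compl] at this
  let F : B → regularLowerSets κ P := fun b => regularLowerSets.mk (U b) (U bᶜ) (hc' b)
  have hF : ∀ b, F bᶜ = (F b)ᶜ := fun b => by
    refine Eq.trans ?_ (regularLowerSets_compl_mk (h' := hc b)).symm
    refine Heyting.Regular.coe_injective (?_ : U bᶜ = U bᶜ)
    rfl
  refine ⟨homOfSup F hF fun I hI a s h => ?_, fun b => rfl⟩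
  rw [← isGLB_range_compl] at h ⊢
  have hi' := hi I hI _ _ h
  simp only [← hF]
  refine ⟨?_, fun x hx p hp => (hi' p).2 fun i => ?_⟩
  · rintro _ ⟨i, rfl⟩ p hp
    exact (hi' p).1 hp i
  · exact hx ⟨i, rfl⟩ hp

/-- Subsets `Z` of a meet-semilattice `L` give homomorphisms to the regular lower sets of the
complement of `Z`, when meets with the values of a map into `L` are compatible with joins modulo
`Z`. -/
theorem exists_hom_of_meets [Fact κ.IsRegular] {B : KBoolAlg κ} {L : Type u} [SemilatticeInf L]
    (Z : Set L) (hZ : IsLowerSet Z) (φ : B → L) (htop : ∀ p, p ⊓ φ ⊤ = p)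
    (hinf : ∀ p x y, p ⊓ φ x ⊓ φ y = p ⊓ φ (x ⊓ y))
    (hsup : ∀ I : Type u, Cardinal.mk I < κ → ∀ (a : I → B) (s : B), IsLUB (Set.range a) s →
      ∀ p, (∀ i, p ⊓ φ (a i) ∈ Z) → p ⊓ φ s ∈ Z) :
    ∃ f : B ⟶ regularLowerSets κ { p : L // p ∉ Z }, ∀ b (p : { p : L // p ∉ Z }),
      p ∈ regularLowerSets.toLowerSet (f b) ↔ p.1 ⊓ φ bᶜ ∈ Z := by
  have hbot : ∀ p, p ⊓ φ ⊥ ∈ Z := fun p =>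
    hsup PEmpty mk_pempty_lt PEmpty.elim ⊥ (by rw [Set.range_eq_empty]; exact isLUB_empty) p
      fun i => i.elim
  have hle : ∀ p x y, x ≤ y → p ⊓ φ x ≤ p ⊓ φ y := fun p x y h => by
    rw [← inf_eq_right.2 h, ← hinf]
    exact inf_le_left
  -- A condition forces `b` when its meet with `φ bᶜ` is declared zero.
  let U : B → LowerSet { p : L // p ∉ Z } := fun b =>
    ⟨{p | p.1 ⊓ φ bᶜ ∈ Z}, fun p q hqp hp => hZ (inf_le_inf_right _ hqp) hp⟩
  have hc : ∀ b p, p ∈ U bᶜ ↔ ∀ q ≤ p, q ∉ U b := fun b p => by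
    change p.1 ⊓ φ bᶜᶜ ∈ Z ↔ ∀ q ≤ p, ¬ q.1 ⊓ φ bᶜ ∈ Z
    rw [compl_compl]
    constructor
    · intro hp q hq hq'
      apply q.2
      -- A condition forcing both `b` and `bᶜ` would lie in `Z`, since `Z` absorbs the join `b ⊔ bᶜ
      -- = ⊤`.
      have := hsup (ULift Bool) mk_ulift_bool_lt (fun x => cond x.down b bᶜ) ⊤
        (by rw [range_ulift_bool, ← sup_compl_eq_top (x := b)]; exact isLUB_pair) q.1 (by
          rintro ⟨_ | _⟩
          · exact hq'
          · exact hZ (inf_le_inf_right _ hq) hp)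
      rwa [htop] at this
    · intro h
      by_contra hp
      refine h ⟨p.1 ⊓ φ b, hp⟩ inf_le_left ?_
      change p.1 ⊓ φ b ⊓ φ bᶜ ∈ Z
      rw [hinf, inf_compl_eq_bot]
      exact hbot _
  have hi : ∀ I : Type u, Cardinal.mk I < κ → ∀ (a : I → B) (s : B), IsGLB (Set.range a) s →
      ∀ p, p ∈ U s ↔ ∀ i, p ∈ U (a i) := fun I hI a s h p => by
    change p.1 ⊓ φ sᶜ ∈ Z ↔ ∀ i, p.1 ⊓ φ (a i)ᶜ ∈ Z
    constructor
    · intro hp i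
      exact hZ (hle _ _ _ (compl_le_compl (h.1 ⟨i, rfl⟩))) hp
    · exact hsup I hI _ _ (isLUB_range_compl.2 h) p.1
  obtain ⟨f, hf⟩ := exists_hom_regularLowerSets U hc hi
  refine ⟨f, fun b p => ?_⟩
  rw [hf]
  exact Iff.rfl

/-- A nonzero element of a member of a diagram. -/
structure NonzeroElement {I : Type u} [Category.{u} I] (F : I ⥤ KBoolAlg κ) : Type u where
  idx : I
  val : F.obj idx
  ne_bot : val ≠ ⊥

open Classical in
/-- Amalgamation with interpolation: a family of spans with common foot `C` has a
cocone in which a meet of elements of the feet vanishes only if this is witnessed in the apices. -/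
theorem exists_amalgam [Fact κ.IsRegular] {I : Type u}
    (A B : I → KBoolAlg κ) (C : KBoolAlg κ) (f : ∀ i, A i ⟶ B i) (g : ∀ i, A i ⟶ C) :
    ∃ (D : KBoolAlg κ) (u : ∀ i, B i ⟶ D) (v : C ⟶ D), (∀ i, f i ≫ u i = g i ≫ v) ∧
      ∀ (c : C) (b : ∀ i, B i), (∀ d, d ≤ v c → (∀ i, d ≤ u i (b i)) → d = ⊥) →
        ∃ a : ∀ i, A i, (∀ i, b i ≤ f i (a i)) ∧ ∀ z ≤ c, (∀ i, z ≤ g i (a i)) → z = ⊥ := by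
  -- A pair stands for the formal meet of its coordinates; `Z` collects the pairs whose vanishing
  -- has a witness `a`.
  let L : Type u := C × ∀ i, B i
  let Z : Set L := {p | ∃ a : ∀ i, A i, (∀ i, p.2 i ≤ f i (a i)) ∧
    ∀ z ≤ p.1, (∀ i, z ≤ g i (a i)) → z = ⊥}
  have hZ : IsLowerSet Z := by
    rintro p q hqp ⟨a, ha, hz⟩
    exact ⟨a, fun i => (hqp.2 i).trans (ha i), fun z hzq => hz z (hzq.trans hqp.1)⟩
  obtain ⟨v, hv⟩ := exists_hom_of_meets (κ := κ) (B := C) Z hZ (fun x => (x, ⊤))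
    (fun p => inf_of_le_left le_top)
    (fun p x y => by rw [inf_assoc]; exact congrArg (p ⊓ ·) (Prod.ext rfl (inf_idem _)))
    (by
      intro J hJ x s hs p hp
      choose a ha hz using hp
      -- For a join in `C`, the meet over `j` of the witnesses works for every `x j` at once.
      refine ⟨fun i => (A i).kInf hJ fun j => a j i, fun i => ?_, fun z hzp hzg => ?_⟩
      · rw [map_kInf]
        exact le_kInf hJ fun j => ha j i
      · rw [← le_bot_iff, ← inf_of_le_left (hzp.trans inf_le_right)]
        refine inf_le_of_isLUB hs fun j => (hz j _ ?_ fun i => ?_).le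
        · exact inf_le_inf_right _ (hzp.trans inf_le_left)
        · exact inf_le_left.trans ((hzg i).trans (OrderHomClass.mono (g i) (kInf_le hJ _ j))))
  let φ : ∀ i, B i → L := fun i x => (⊤, Function.update (fun j => (⊤ : B j)) i x)
  have hφ : ∀ i (p : L) (x : B i), p ⊓ φ i x =
      (p.1, Function.update p.2 i (p.2 i ⊓ x)) := fun i p x => by
    refine Prod.ext (inf_of_le_left le_top) (funext fun j => ?_)
    change p.2 j ⊓ Function.update (fun j => (⊤ : B j)) i x j = _
    by_cases hj : j = i
    · subst hj; simp
    · simp [Function.update_of_ne hj]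
  have hu : ∀ i, ∃ u : B i ⟶ regularLowerSets κ { p : L // p ∉ Z }, ∀ b (p : { p : L // p ∉ Z }),
      p ∈ regularLowerSets.toLowerSet (u b) ↔ (p.1.1, Function.update p.1.2 i (p.1.2 i ⊓ bᶜ)) ∈ Z := by
    intro i
    obtain ⟨u, hu⟩ := exists_hom_of_meets (κ := κ) (B := B i) Z hZ
      (φ i) (fun p => by rw [hφ]; simp)
      (fun p x y => by rw [hφ, hφ, hφ]; simp [inf_assoc])
      (by
        intro J hJ x s hs p hp
        simp only [hφ] at hp ⊢
        choose a ha hz using hp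
        -- For a join in `B i`, the witness must bound that join in coordinate `i`, hence a join
        -- there; the other coordinates take meets.
        refine ⟨Function.update (fun i => (A i).kInf hJ fun j => a j i) i
          ((A i).kSup hJ fun j => a j i), fun k => ?_, fun z hzp hzg => ?_⟩
        · by_cases hk : k = i
          · subst hk
            simp only [Function.update_self]
            refine inf_le_of_isLUB hs fun j => ?_
            have := ha j k
            simp only [Function.update_self] at this
            exact this.trans (OrderHomClass.mono (f k) (le_kSup hJ (fun j => a j k) j))
          · simp only [Function.update_of_ne hk, map_kInf]
            refine le_kInf hJ fun j => ?_
            have := ha j k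
            simpa only [Function.update_of_ne hk] using this
        · have h1 := hzg i
          simp only [Function.update_self, map_kSup] at h1
          rw [← le_bot_iff, ← inf_of_le_left h1]
          refine inf_kSup_le hJ fun j => (hz j _ (inf_le_left.trans hzp) fun k => ?_).le
          by_cases hk : k = i
          · subst hk; exact inf_le_right
          · have h2 := hzg k
            simp only [Function.update_of_ne hk] at h2
            exact inf_le_left.trans
              (h2.trans (OrderHomClass.mono (g k) (kInf_le hJ (fun j => a j k) j))))
    exact ⟨u, fun b p => by rw [hu, hφ]⟩
  choose u hu using hu
  refine ⟨regularLowerSets κ { p : L // p ∉ Z }, u, v, fun i => hom_ext fun x => ?_,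
    fun c b h => ?_⟩
  · refine Heyting.Regular.coe_injective (SetLike.ext fun p => ?_)
    refine (hu i (f i x) p).trans (Iff.trans ?_ (hv (g i x) p).symm)
    rw [← map_compl', ← map_compl']
    generalize xᶜ = y
    constructor
    · rintro ⟨a, ha, hz⟩
      -- A factor `f i y` on the `B i` side and a factor `g i y` on the `C` side are
      -- interchangeable: the witness changes to `y ⇨ a i` in one direction and to `a i ⊓ y` in the
      -- other.
      refine ⟨Function.update a i (a i ⊔ yᶜ), fun k => ?_, fun z hzp hzg => ?_⟩
      · have := ha k
        by_cases hk : k = i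
        · subst hk
          simp only [Function.update_self] at this ⊢
          refine inf_le_left.trans ?_
          rw [map_sup, map_compl', ← himp_eq, le_himp_iff]
          exact this
        · simp only [Function.update_of_ne hk] at this ⊢
          exact inf_le_left.trans this
      · refine hz z (hzp.trans inf_le_left) fun k => ?_
        have := hzg k
        by_cases hk : k = i
        · subst hk
          simp only [Function.update_self] at this
          rw [map_sup, map_compl', ← himp_eq, le_himp_iff] at this
          rwa [inf_of_le_left (hzp.trans inf_le_right)] at this
        · simpa only [Function.update_of_ne hk] using this
    · rintro ⟨a, ha, hz⟩
      refine ⟨Function.update a i (a i ⊓ y), fun k => ?_, fun z hzp hzg => ?_⟩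
      · have := ha k
        change p.1.2 k ⊓ ⊤ ≤ _ at this
        rw [inf_top_eq] at this
        by_cases hk : k = i
        · subst hk
          simp only [Function.update_self, map_inf]
          exact inf_le_inf_right _ this
        · simpa only [Function.update_of_ne hk] using this
      · have h1 := hzg i
        simp only [Function.update_self, map_inf] at h1
        refine hz z (le_inf hzp (h1.trans inf_le_right)) fun k => ?_
        by_cases hk : k = i
        · subst hk
          exact h1.trans inf_le_left
        · have := hzg k
          simpa only [Function.update_of_ne hk] using this
  · by_contra hcb
    have hp : (c, b) ∉ Z := hcb
    -- If `(c, b)` has no witness, it is a condition. Its regularized principal lower set `d` lies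
    -- below `v c` and all `u i (b i)`, so it is zero by hypothesis, although it contains `(c, b)`.
    let W : LowerSet { p : L // p ∉ Z } := LowerSet.Iic ⟨(c, b), hp⟩
    let d : Heyting.Regular (LowerSet { p : L // p ∉ Z }) := Heyting.Regular.toRegular W
    have hd : ∀ e : Heyting.Regular (LowerSet { p : L // p ∉ Z }), d ≤ e ↔
        (⟨(c, b), hp⟩ : { p : L // p ∉ Z }) ∈ (e : LowerSet { p : L // p ∉ Z }) := fun e =>
      (Heyting.Regular.gi.gc W e).trans LowerSet.Iic_le
    have hbotZ : ∀ q : L, q.1 = ⊥ → q ∈ Z := fun q hq =>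
      ⟨⊤, fun i => by simp, fun z hz _ => le_bot_iff.1 (hq ▸ hz)⟩
    have := h d ((hd _).2 ((hv _ _).2 (hbotZ _ (inf_compl_self c)))) fun i =>
      (hd _).2 ((hu _ _ _).2 ?_)
    · have h1 := (hd _).1 this.le
      exact h1
    · refine ⟨Function.update ⊤ i ⊥, fun k => ?_, fun z hzp hzg => ?_⟩
      · by_cases hk : k = i
        · subst hk; simp
        · simp [Function.update_of_ne hk]
      · have := hzg i
        simpa using this

/-- The colimit of a directed diagram of injections has a cocone of injections. -/
theorem exists_directed_amalgam [Fact κ.IsRegular] {I : Type u} [PartialOrder I]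
    [IsDirectedOrder I] (F : I ⥤ KBoolAlg κ)
    (hF : ∀ ⦃i j : I⦄ (f : i ⟶ j), Function.Injective (F.map f)) :
    ∃ (D : KBoolAlg κ) (u : ∀ i, F.obj i ⟶ D), (∀ ⦃i j : I⦄ (f : i ⟶ j), F.map f ≫ u j = u i) ∧
      ∀ i, Function.Injective (u i) := by
  let R : (Σ i, F.obj i) → (Σ i, F.obj i) → Prop := fun p q =>
    ∃ (k : I) (hp : p.1 ≤ k) (hq : q.1 ≤ k), F.map (homOfLE hp) p.2 ≤ F.map (homOfLE hq) q.2
  have hmap : ∀ {i j k : I} (h1 : i ≤ j) (h2 : j ≤ k) (x : F.obj i),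
      F.map (homOfLE h2) (F.map (homOfLE h1) x) = F.map (homOfLE (h1.trans h2)) x := by
    intro i j k h1 h2 x
    rw [← comp_apply, ← F.map_comp]
    rfl
  -- Injectivity of the transition maps makes the comparison independent of the chosen upper bound.
  have hR : ∀ {p q : Σ i, F.obj i} {k : I} (hp : p.1 ≤ k) (hq : q.1 ≤ k),
      R p q ↔ F.map (homOfLE hp) p.2 ≤ F.map (homOfLE hq) q.2 := by
    intro p q k hp hq
    refine ⟨?_, fun h => ⟨k, hp, hq, h⟩⟩
    rintro ⟨l, hp', hq', h⟩
    obtain ⟨m, hkm, hlm⟩ := exists_ge_ge k l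
    rw [← le_iff_of_injective (hF (homOfLE hlm)), hmap, hmap] at h
    rwa [← le_iff_of_injective (hF (homOfLE hkm)), hmap, hmap]
  let P : Type u := NonzeroElement F
  let el : P → Σ i, F.obj i := fun p => ⟨p.idx, p.val⟩
  have hRt : ∀ {p q r : Σ i, F.obj i}, R p q → R q r → R p r := by
    intro p q r hpq hqr
    obtain ⟨m, hm1, hm2⟩ := exists_ge_ge p.1 q.1
    obtain ⟨n, hn1, hn2⟩ := exists_ge_ge m r.1
    rw [hR (hm1.trans hn1) (hm2.trans hn1)] at hpq
    rw [hR (hm2.trans hn1) hn2] at hqr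
    exact ⟨n, hm1.trans hn1, hn2, hpq.trans hqr⟩
  let _ : Preorder P :=
    { le := fun p q => R (el p) (el q)
      le_refl := fun p => ⟨p.idx, le_rfl, le_rfl, le_rfl⟩
      le_trans := fun p q r => hRt }
  have hu : ∀ i, ∃ u : F.obj i ⟶ regularLowerSets κ P, ∀ b,
      regularLowerSets.toLowerSet (u b) =
        ⟨{p : P | R (el p) ⟨i, b⟩}, fun p q (hqp : R (el q) (el p)) hp => hRt hqp hp⟩ := by
    intro i
    refine exists_hom_regularLowerSets _ (fun b p => ?_) (fun J hJ a s h p => ?_)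
    · change R (el p) ⟨i, bᶜ⟩ ↔ ∀ q : P, R (el q) (el p) → ¬ R (el q) ⟨i, b⟩
      constructor
      · intro hp q hq hqb
        obtain ⟨m, hm1, hm2⟩ := exists_ge_ge q.idx i
        rw [hR (q := ⟨i, b⟩) hm1 hm2] at hqb
        have h1 := hRt hq hp
        rw [hR (q := ⟨i, bᶜ⟩) hm1 hm2, map_compl'] at h1
        apply q.ne_bot
        rw [← (injective_iff _).1 (hF (homOfLE hm1)) q.val ?_]
        exact le_bot_iff.1 ((le_inf hqb h1).trans (inf_compl_self _).le)
      · intro h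
        obtain ⟨m, hm1, hm2⟩ := exists_ge_ge p.idx i
        rw [hR (q := ⟨i, bᶜ⟩) hm1 hm2, map_compl']
        by_contra hp
        rw [le_compl_iff_disjoint_right, disjoint_iff] at hp
        -- The nonzero meet of `p` and `b` at stage `m` is a condition below both.
        refine h ⟨m, _, hp⟩ ((hR (k := m) le_rfl hm1).2 ?_) ((hR (k := m) le_rfl hm2).2 ?_)
        all_goals
          refine le_trans (le_of_eq (congrFun (congrArg _ (F.map_id m)) _)) ?_
        · exact inf_le_left
        · exact inf_le_right
    · change R (el p) ⟨i, s⟩ ↔ ∀ j, R (el p) ⟨i, a j⟩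
      -- One stage `m` serves to compare `p` with all the `a j`, and the transition map to it
      -- preserves their meet.
      obtain ⟨m, hm1, hm2⟩ := exists_ge_ge p.idx i
      have hRi : ∀ y, R (el p) ⟨i, y⟩ ↔ F.map (homOfLE hm1) p.val ≤ F.map (homOfLE hm2) y :=
        fun y => hR (p := el p) (q := ⟨i, y⟩) hm1 hm2
      simp only [hRi]
      have h' := isLUB_range_map (F.map (homOfLE hm2)) hJ (isLUB_range_compl.2 h)
      simp only [map_compl'] at h'
      rw [isLUB_range_compl] at h'
      rw [le_isGLB_iff h']
      simp [lowerBounds]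
  choose u hu using hu
  refine ⟨_, u, fun i j f => hom_ext fun x => ?_, fun i => (injective_iff _).2 fun x hx => ?_⟩
  · refine Heyting.Regular.coe_injective (SetLike.ext fun p => ?_)
    have h1 := SetLike.ext_iff.1 (hu j (F.map f x)) p
    have h2 := SetLike.ext_iff.1 (hu i x) p
    refine h1.trans (Iff.trans ?_ h2.symm)
    change R (el p) ⟨j, F.map f x⟩ ↔ R (el p) ⟨i, x⟩
    obtain ⟨m, hm1, hm2⟩ := exists_ge_ge p.idx j
    rw [hR (q := ⟨j, _⟩) hm1 hm2, hR (q := ⟨i, _⟩) hm1 ((leOfHom f).trans hm2)]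
    rw [← hmap (leOfHom f) hm2 x]
    rfl
  · by_contra hne
    -- A nonzero `x` is itself a condition in its image, which therefore is not empty.
    have h2 := SetLike.ext_iff.1 (hu i x) ⟨i, x, hne⟩
    have h3 := h2.2 ⟨i, le_rfl, le_rfl, le_rfl⟩
    rw [hx] at h3
    exact h3

end KBoolAlg

/-! ### Analytic algebras: interpolation, quotients and products -/

/-- The meet of two terms. -/
def KBoolTerm.inf {κ : Cardinal.{u}} [Fact κ.IsRegular] {G : Type u} (s t : KBoolTerm κ G) :
    KBoolTerm κ G :=
  .compl (.sup (ULift Bool) mk_ulift_bool_lt fun b => cond b.down s.compl t.compl)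

theorem KBoolTerm.eval_inf {κ : Cardinal.{u}} [Fact κ.IsRegular] {G : Type u} (A : KBoolAlg κ)
    (f : G → A) (s t : KBoolTerm κ G) : (s.inf t).eval A f = s.eval A f ⊓ t.eval A f := by
  have h := A.isLUB_kSup mk_ulift_bool_lt fun b : ULift Bool =>
    (cond b.down s.compl t.compl).eval A f
  have e : (fun b : ULift.{u} Bool => (cond b.down s.compl t.compl).eval A f) =
      fun b => cond b.down (s.compl.eval A f) (t.compl.eval A f) := by
    funext ⟨b⟩
    cases b <;> rfl
  have h' := h
  rw [e, range_ulift_bool] at h'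
  change (A.kSup mk_ulift_bool_lt fun b : ULift.{u} Bool =>
    (cond b.down s.compl t.compl).eval A f)ᶜ = _
  rw [e, h'.unique isLUB_pair]
  simp only [KBoolTerm.eval, compl_sup, compl_compl]

/-- The empty join. -/
def KBoolTerm.bot {κ : Cardinal.{u}} [Fact κ.IsRegular] {G : Type u} : KBoolTerm κ G :=
  .sup PEmpty mk_pempty_lt PEmpty.elim

theorem KBoolTerm.eval_bot {κ : Cardinal.{u}} [Fact κ.IsRegular] {G : Type u} (A : KBoolAlg κ)
    (f : G → A) : (KBoolTerm.bot : KBoolTerm κ G).eval A f = ⊥ :=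
  le_bot_iff.1 (kSup_le _ fun i => i.elim)

namespace KBoolAlg

variable {κ : Cardinal.{u}}

theorem surjective_of_isGenBy {A B : KBoolAlg κ} (f : A ⟶ B) {G : Type u} {η : G → B}
    (hη : B.IsGenBy η) (h : ∀ g, ∃ x, f x = η g) : Function.Surjective f := by
  choose a ha using h
  intro y
  obtain ⟨t, rfl⟩ := hη y
  exact ⟨t.eval A a, by simp only [KBoolTerm.map_eval, ha]⟩

theorem IsGenBy.of_surjective {A B : KBoolAlg κ} (f : A ⟶ B) (hf : Function.Surjective f)
    {G : Type u} {η : G → A} (hη : A.IsGenBy η) : B.IsGenBy fun g => f (η g) := by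
  intro y
  obtain ⟨x, rfl⟩ := hf y
  obtain ⟨t, rfl⟩ := hη x
  exact ⟨t, (KBoolTerm.map_eval f η t).symm⟩

/-- The algebras dual to analytic `κ`-Borel locales: those with `< κ` generators that embed in
a `κ`-presented algebra. -/
def IsAnalytic (A : KBoolAlg κ) : Prop :=
  (∃ (G : Type u) (η : G → A), Cardinal.mk G < κ ∧ A.IsGenBy η) ∧
    ∃ (B : KBoolAlg κ) (m : A ⟶ B), B.IsKPresented ∧ Function.Injective m

theorem IsAnalytic.of_surjective_injective {A Z B : KBoolAlg κ} (hA : A.IsAnalytic)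
    (hB : B.IsAnalytic) (e : A ⟶ Z) (he : Function.Surjective e) (m : Z ⟶ B)
    (hm : Function.Injective m) : Z.IsAnalytic := by
  obtain ⟨⟨G, η, hG, hη⟩, -⟩ := hA
  obtain ⟨-, C, k, hC, hk⟩ := hB
  exact ⟨⟨G, _, hG, hη.of_surjective e he⟩, C, m ≫ k, hC, hk.comp hm⟩

variable [Fact κ.IsRegular]

/-- Craig interpolation: `v c ≤ u b` says that `c` and `bᶜ` have meet zero in the amalgam, and the
complement of the resulting witness is the interpolant. -/
theorem exists_binary_amalgam {A B C : KBoolAlg κ} (f : A ⟶ B) (g : A ⟶ C) :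
    ∃ (D : KBoolAlg κ) (u : B ⟶ D) (v : C ⟶ D), f ≫ u = g ≫ v ∧
      ∀ (c : C) (b : B), v c ≤ u b → ∃ a, c ≤ g a ∧ f a ≤ b := by
  obtain ⟨D, u, v, huv, h⟩ := exists_amalgam (I := PUnit.{u + 1}) (fun _ => A) (fun _ => B) C
    (fun _ => f) fun _ => g
  refine ⟨D, u ⟨⟩, v, huv ⟨⟩, fun c b hcb => ?_⟩
  obtain ⟨a, ha, hz⟩ := h c (fun _ => bᶜ) fun d hd hd' => by
    have := hd' ⟨⟩
    rw [map_compl'] at this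
    exact le_bot_iff.1 ((le_inf (hd.trans hcb) this).trans (inf_compl_self _).le)
  refine ⟨(a ⟨⟩)ᶜ, ?_, ?_⟩
  · rw [map_compl', le_compl_iff_disjoint_right, disjoint_iff]
    exact hz _ inf_le_left fun _ => inf_le_right
  · rw [map_compl']
    exact compl_le_iff_compl_le.1 (ha ⟨⟩)

/-- With every `b i = ⊤`, injectivity forces each witness `a i` to be `⊤`, so an element killed by
`v` is already zero. -/
theorem exists_injective_amalgam {I : Type u} (A B : I → KBoolAlg κ) (C : KBoolAlg κ)
    (f : ∀ i, A i ⟶ B i) (g : ∀ i, A i ⟶ C) (hf : ∀ i, Function.Injective (f i)) :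
    ∃ (D : KBoolAlg κ) (u : ∀ i, B i ⟶ D) (v : C ⟶ D), (∀ i, f i ≫ u i = g i ≫ v) ∧
      Function.Injective v := by
  obtain ⟨D, u, v, huv, h⟩ := exists_amalgam A B C f g
  refine ⟨D, u, v, huv, (injective_iff v).2 fun c hc => ?_⟩
  obtain ⟨a, ha, hz⟩ := h c (fun _ => ⊤) fun d hd _ => le_bot_iff.1 (hd.trans hc.le)
  refine hz c le_rfl fun i => ?_
  have : a i = ⊤ := hf i ((top_le_iff.1 (ha i)).trans (map_top (f i)).symm)
  rw [this, map_top]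
  exact le_top

/-- The quotient by the principal ideal of the complement of `δ`. -/
theorem exists_quotient {A : KBoolAlg κ} (δ : A) :
    ∃ (Q : KBoolAlg κ) (q : A ⟶ Q), Function.Surjective q ∧ ∀ x, q x = ⊥ ↔ x ⊓ δ = ⊥ := by
  let Z : Set A := {x | x ⊓ δ = ⊥}
  have hZ : IsLowerSet Z := fun x y hxy hx =>
    le_bot_iff.1 ((inf_le_inf_right _ hxy).trans (le_of_eq hx))
  -- Forcing with the elements that meet `δ` gives a homomorphism with the required kernel; its
  -- image is the quotient.
  obtain ⟨f, hf⟩ := exists_hom_of_meets (κ := κ) (B := A) Z hZ id (fun p => inf_top_eq p)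
    (fun p x y => inf_assoc _ _ _) fun I hI a s hs p hp => by
      change p ⊓ s ⊓ δ = ⊥
      rw [inf_right_comm, ← le_bot_iff]
      refine inf_le_of_isLUB hs fun i => ?_
      rw [inf_right_comm]
      exact (hp i).le
  have key : ∀ x, f x = ⊥ ↔ x ⊓ δ = ⊥ := fun x => by
    rw [← map_bot f]
    constructor
    · intro h
      by_contra hx
      have h1 := (hf x ⟨x, hx⟩).2 (hZ (inf_compl_self x).le (bot_inf_eq _))
      rw [h, hf] at h1
      apply hx
      rwa [id, compl_bot, inf_top_eq] at h1
    · intro hx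
      refine Heyting.Regular.coe_injective (SetLike.ext fun p => ?_)
      refine (hf x p).trans (Iff.trans ?_ (hf ⊥ p).symm)
      refine iff_of_false (fun hp => p.2 ?_) fun hp => p.2 ?_
      · change p.1 ⊓ xᶜ ⊓ δ = ⊥ at hp
        have h2 : p.1 ⊓ δ = (p.1 ⊓ xᶜ ⊓ δ) ⊔ (p.1 ⊓ (x ⊓ δ)) := by
          rw [← inf_assoc, ← inf_sup_right, ← inf_sup_left, compl_sup_eq_top, inf_top_eq]
        change p.1 ⊓ δ = ⊥
        rw [h2, hp, hx, inf_bot_eq, sup_bot_eq]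
      · rwa [id, compl_bot, inf_top_eq] at hp
  obtain ⟨Q, q, m, hqm, hq, hm⟩ := exists_image f
  refine ⟨Q, q, hq, fun x => ?_⟩
  rw [← key, ← hqm, comp_apply]
  exact ⟨fun h => by rw [h, map_bot], (injective_iff m).1 hm _⟩

/-- A partition of unity decomposes an algebra as the product of the quotients. -/
theorem bijective_piLift {I : Type u} (hI : Cardinal.mk I < κ) {C : KBoolAlg κ}
    {Q : I → KBoolAlg κ} (q : ∀ i, C ⟶ Q i) (hq : ∀ i, Function.Surjective (q i)) (δ : I → C)
    (hker : ∀ i x, q i x = ⊥ ↔ x ⊓ δ i = ⊥) (hdisj : ∀ i j, i ≠ j → δ i ⊓ δ j = ⊥)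
    (hcov : IsLUB (Set.range δ) ⊤) : Function.Bijective (piLift q) := by
  constructor
  · refine (injective_iff _).2 fun x hx => ?_
    rw [← le_bot_iff, ← inf_top_eq x]
    refine inf_le_of_isLUB hcov fun i => le_of_eq ((hker i x).1 ?_)
    exact congrFun hx i
  · intro y
    choose z hz using fun i => hq i (y i)
    have h0 : ∀ i j, i ≠ j → q j (δ i) = ⊥ := fun i j hij => (hker j _).2 (hdisj i j hij)
    have h1 : ∀ j, q j (δ j) = ⊤ := fun j => by
      rw [← compl_eq_bot, ← map_compl', hker, compl_inf_self]
    refine ⟨C.kSup hI fun i => δ i ⊓ z i, funext fun j => ?_⟩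
    rw [piLift_apply, map_kSup]
    apply le_antisymm
    · refine kSup_le hI fun i => ?_
      rw [map_inf]
      by_cases hij : i = j
      · subst hij
        exact inf_le_right.trans (hz i).le
      · rw [h0 i j hij, bot_inf_eq]
        exact bot_le
    · refine le_trans ?_ (le_kSup hI _ j)
      rw [map_inf, h1, top_inf_eq, hz]

theorem IsKPresented.isAnalytic {A : KBoolAlg κ} (h : A.IsKPresented) : A.IsAnalytic := by
  obtain ⟨G, R, l, l', η, hG, hR, hA⟩ := id h
  exact ⟨⟨G, η, hG, hA.isGenBy⟩, A, 𝟙 A, h, fun x y h => h⟩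

open Classical in
/-- Products of `< κ` analytic algebras are analytic. -/
theorem IsAnalytic.pi {I : Type u} (hI : Cardinal.mk I < κ) {A : I → KBoolAlg κ}
    (hA : ∀ i, (A i).IsAnalytic) : (KBoolAlg.pi A).IsAnalytic := by
  choose hgen B m hB hm using hA
  choose G η hG hη using hgen
  choose G' R l l' θ hG' hR hB using hB
  have hII : Cardinal.mk (I × I) < κ := by
    rw [Cardinal.mk_prod, Cardinal.lift_id]
    exact Cardinal.mul_lt_of_lt (Fact.out (p := κ.IsRegular)).aleph0_le hI hI
  constructor
  · let δ : I → KBoolAlg.pi A := fun i j => if j = i then ⊤ else ⊥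
    let pad : (Σ i, G i) → KBoolAlg.pi A := fun p j => if h : p.1 = j then h ▸ η p.1 p.2 else ⊥
    have hpad : ∀ i g, piProj A i (pad ⟨i, g⟩) = η i g := fun i g =>
      show (if h : i = i then h ▸ η i g else ⊥) = η i g from dif_pos rfl
    refine ⟨(Σ i, G i) ⊕ I, Sum.elim pad δ, mk_sum_lt (mk_sigma_lt hI hG) hI, fun x => ?_⟩
    choose t ht using fun i => hη i (x i)
    refine ⟨.sup I hI fun i => (KBoolTerm.var (Sum.inr i)).inf
      ((t i).rename fun g => Sum.inl ⟨i, g⟩), ?_⟩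
    have ht' : ∀ i, ((t i).rename fun g => Sum.inl ⟨i, g⟩).eval (KBoolAlg.pi A)
        (Sum.elim pad δ) i = x i := fun i => by
      rw [KBoolTerm.eval_rename]
      change piProj A i _ = x i
      rw [KBoolTerm.map_eval]
      simp only [Sum.elim_inl, hpad]
      exact ht i
    simp only [KBoolTerm.eval, KBoolTerm.eval_inf, Sum.elim_inr]
    refine IsLUB.unique (isLUB_kSup _ hI _) ⟨?_, fun y hy j => ?_⟩
    · rintro _ ⟨i, rfl⟩ j
      by_cases hij : j = i
      · subst hij
        exact inf_le_right.trans (ht' j).le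
      · refine inf_le_left.trans ?_
        simp [δ, hij]
    · refine le_trans ?_ (hy ⟨j, rfl⟩ j)
      refine le_inf ?_ (ht' j).ge
      simp [δ]
  · let r : ∀ i, KBoolTerm κ (G' i) → KBoolTerm κ ((Σ i, G' i) ⊕ I) := fun i t =>
      (KBoolTerm.var (Sum.inr i)).inf (t.rename fun g => Sum.inl ⟨i, g⟩)
    -- Besides the generators of all the `B i` there is a partition of unity, and the relations of
    -- `B i` are imposed only below its `i`-th piece. So `Q` is the product of its quotients by the
    -- pieces.
    obtain ⟨Q, ζ, hQ, hζ⟩ := exists_isPresentedBy (κ := κ) (G := (Σ i, G' i) ⊕ I)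
      (R := PUnit ⊕ { p : I × I // p.1 ≠ p.2 } ⊕ Σ i, R i)
      (Sum.elim (fun _ => .sup I hI fun i => .var (Sum.inr i))
        (Sum.elim (fun p => (KBoolTerm.var (Sum.inr p.1.1)).inf (.var (Sum.inr p.1.2)))
          fun p => r p.1 (l p.1 p.2)))
      (Sum.elim (fun _ => .compl .bot) (Sum.elim (fun _ => .bot) fun p => r p.1 (l' p.1 p.2)))
    have hQP : Q.IsKPresented := ⟨_, _, _, _, ζ, mk_sum_lt (mk_sigma_lt hI hG') hI,
      mk_sum_lt mk_punit_lt (mk_sum_lt ((Cardinal.mk_subtype_le _).trans_lt hII)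
        (mk_sigma_lt hI hR)), hQ⟩
    have hsup := hQ.relations (Sum.inl ⟨⟩)
    have hdis := fun p => hQ.relations (Sum.inr (Sum.inl p))
    have hrel := fun p => hQ.relations (Sum.inr (Sum.inr p))
    simp only [Sum.elim_inl, Sum.elim_inr, KBoolTerm.eval, KBoolTerm.eval_bot, compl_bot,
      KBoolTerm.eval_inf, KBoolTerm.eval_rename, r] at hsup hdis hrel
    choose q' q hq hker using fun i => exists_quotient (ζ (Sum.inr i))
    have hbij := bijective_piLift hI q hq (fun i => ζ (Sum.inr i)) hker
      (fun i j hij => hdis ⟨(i, j), hij⟩) (by rw [← hsup]; exact isLUB_kSup _ hI _)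
    have h1 : ∀ i, q i (ζ (Sum.inr i)) = ⊤ := fun i => by
      rw [← compl_eq_bot, ← map_compl', hker, compl_inf_self]
    have hk : ∀ i, ∃ k : B i ⟶ q' i, ∀ g, k (θ i g) = q i (ζ (Sum.inl ⟨i, g⟩)) := fun i =>
      (hB i).exists_hom _ fun x => by
        have := congrArg (q i) (hrel ⟨i, x⟩)
        simpa only [map_inf, h1, top_inf_eq, KBoolTerm.map_eval] using this
    choose k hk using hk
    -- The quotient `q' i` still contains the generators of the other blocks. Sending these to `⊥`
    -- exhibits `B i` as a retract, which is enough for an embedding.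
    have hretr : ∀ i, ∃ s : q' i ⟶ B i, k i ≫ s = 𝟙 _ := fun i => by
      obtain ⟨s, hs⟩ := hQ.exists_hom (B := B i) (Sum.elim
        (fun p => if h : p.1 = i then θ i (h ▸ p.2) else ⊥) fun j => if j = i then ⊤ else ⊥) (by
          rintro (⟨⟩ | p | ⟨j, x⟩)
          · simp only [Sum.elim_inl, Sum.elim_inr, KBoolTerm.eval, KBoolTerm.eval_bot, compl_bot]
            refine top_le_iff.1 (le_trans ?_ (le_kSup hI _ i))
            simp
          · simp only [Sum.elim_inl, Sum.elim_inr, KBoolTerm.eval, KBoolTerm.eval_bot,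
              KBoolTerm.eval_inf]
            by_cases h : p.1.1 = i
            · have : p.1.2 ≠ i := fun h' => p.2 (h.trans h'.symm)
              simp [this]
            · simp [h]
          · simp only [Sum.elim_inl, Sum.elim_inr, KBoolTerm.eval,
              KBoolTerm.eval_inf, KBoolTerm.eval_rename, r]
            by_cases h : j = i
            · subst h
              simp only [dif_pos, (hB j).relations x]
            · simp [h])
      obtain ⟨s', hs'⟩ := exists_factor_of_surjective (q i) (hq i) s fun x hx => by
        have h2 := congrArg s ((hker i x).1 hx)
        have h3 : s (ζ (Sum.inr i)) = ⊤ := by rw [hs]; simp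
        rwa [map_inf, h3, inf_top_eq, map_bot] at h2
      refine ⟨s', (hB i).isGenBy.hom_ext fun g => ?_⟩
      rw [comp_apply, hk, ← comp_apply, hs', hs]
      simp
    choose s hs using hretr
    have := isIso_of_bijective _ hbij
    refine ⟨Q, piLift (fun i => piProj A i ≫ m i ≫ k i) ≫ inv (piLift q), hQP, ?_⟩
    have hinv : Function.Injective (inv (piLift q)) := fun x y hxy => by
      have := congrArg (piLift q) hxy
      rwa [← comp_apply, ← comp_apply, IsIso.inv_hom_id] at this
    refine hinv.comp fun x y hxy => funext fun i => hm i ?_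
    have h4 : s i (k i (m i (x i))) = s i (k i (m i (y i))) := congrArg (s i) (congrFun hxy i)
    have h5 : ∀ z, s i (k i z) = z := fun z => by rw [← comp_apply, hs, id_apply]
    rwa [h5, h5] at h4

end KBoolAlg

/-! ### Limits, monomorphisms, epimorphisms and images of `κ`-Borel locales -/

namespace KBorLoc

variable {κ : Cardinal.{u}}

section Limits

variable {J : Type w} [Category.{v} J] {F : J ⥤ KBorLoc κ} {c : Cone F}

theorem exists_lift (hc : IsLimit c) {D : KBoolAlg κ} (h : ∀ j, (F.obj j).unop ⟶ D)
    (hh : ∀ ⦃j j' : J⦄ (φ : j ⟶ j'), (F.map φ).unop ≫ h j = h j') :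
    ∃ k : c.pt.unop ⟶ D, ∀ j, (c.π.app j).unop ≫ k = h j := by
  let s : Cone F :=
    { pt := op D
      π :=
        { app := fun j => (h j).op
          naturality := fun j j' φ => Quiver.Hom.unop_inj (by simp [hh]) } }
  exact ⟨(hc.lift s).unop, fun j => Quiver.Hom.op_inj (hc.fac s j)⟩

theorem unop_hom_ext (hc : IsLimit c) {D : KBoolAlg κ} {k k' : c.pt.unop ⟶ D}
    (h : ∀ j, (c.π.app j).unop ≫ k = (c.π.app j).unop ≫ k') : k = k' :=
  Quiver.Hom.op_inj (hc.hom_ext fun j => Quiver.Hom.unop_inj (h j))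

end Limits

theorem mono_of_surjective {X Y : KBorLoc κ} (f : X ⟶ Y) (hf : Function.Surjective f.unop) :
    Mono f where
  right_cancellation g h e := Quiver.Hom.unop_inj (KBoolAlg.hom_ext fun x => by
    obtain ⟨y, rfl⟩ := hf x
    have := congrArg (fun k => k.unop y) e
    exact this)

theorem epi_of_injective {X Y : KBorLoc κ} (f : X ⟶ Y) (hf : Function.Injective f.unop) :
    Epi f where
  left_cancellation g h e := Quiver.Hom.unop_inj (KBoolAlg.hom_ext fun x => hf (by
    exact congrArg (fun k => k.unop x) e))

variable [Fact κ.IsRegular]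

/-- The colimit of the algebras is the generic algebra on all their elements, for the class of
compatible families of homomorphisms. Equality is tested on that class, so the generators themselves
form such a family. -/
theorem hasLimitsOfShape (J : Type u) [SmallCategory J] : HasLimitsOfShape J (KBorLoc κ) where
  has_limit F := by
    let A : J → KBoolAlg κ := fun j => (F.obj j).unop
    obtain ⟨C, η, hη, hu, hj⟩ := exists_generic (κ := κ) (Σ j, A j) fun B f =>
      (∀ j, ∃ h : A j ⟶ B, ∀ x, h x = f ⟨j, x⟩) ∧
        ∀ (j j' : J) (φ : j ⟶ j') x, f ⟨j, (F.map φ).unop x⟩ = f ⟨j', x⟩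
    let e : ∀ j, A j ⟶ C := fun j => homOfSup (fun x => η ⟨j, x⟩)
      (fun x => hj _ _ fun B h hB => by
        obtain ⟨k, hk⟩ := hB.1 j
        dsimp only at hk
        rw [map_compl', ← hk, ← hk, map_compl'])
      (fun I hI a s hs => by
        have : η ⟨j, s⟩ = C.kSup hI fun i => η ⟨j, a i⟩ := hj _ _ fun B h hB => by
          obtain ⟨k, hk⟩ := hB.1 j
          dsimp only at hk
          rw [map_kSup]
          simp only [← hk]
          exact (isLUB_range_map k hI hs).unique (isLUB_kSup _ hI _)
        rw [this]
        exact isLUB_kSup _ hI _)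
    refine ⟨⟨⟨⟨op C, ⟨fun j => (e j).op, fun j j' φ => Quiver.Hom.unop_inj ?_⟩⟩, ?_⟩⟩⟩
    · refine KBoolAlg.hom_ext fun x => ?_
      exact (hj _ _ fun B h hB => hB.2 j j' φ x).symm
    · have hlift : ∀ s : Cone F, ∃ k : C ⟶ s.pt.unop, ∀ g, k (η g) = (s.π.app g.1).unop g.2 :=
        fun s => hu _ _ ⟨fun j => ⟨(s.π.app j).unop, fun x => rfl⟩, fun j j' φ x => by
          rw [← s.w φ]
          rfl⟩
      choose k hk using hlift
      refine
        { lift := fun s => (k s).op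
          fac := fun s j => Quiver.Hom.unop_inj (KBoolAlg.hom_ext fun x => hk s ⟨j, x⟩)
          uniq := fun s m hm => Quiver.Hom.unop_inj (hη.hom_ext fun g => ?_) }
      refine Eq.trans ?_ (hk s g).symm
      rw [← hm g.1]
      rfl

/-- An analytic algebra as the algebra of a limit of `κ`-Borel locales. -/
theorem isAnalytic_of_isLimit {J : Type u} [SmallCategory J] (hJ : Cardinal.mk (Arrow J) < κ)
    {F : J ⥤ KBorLoc κ} {c : Cone F} (hc : IsLimit c)
    (hF : ∀ j, KBoolAlg.IsAnalytic (F.obj j).unop) : KBoolAlg.IsAnalytic c.pt.unop := by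
  have hJ' : Cardinal.mk J < κ :=
    (Cardinal.mk_le_of_injective (f := fun j : J => Arrow.mk (𝟙 j)) fun j j' h =>
      congrArg Comma.left h).trans_lt hJ
  choose hgen B m hB hm using hF
  choose G η hG hη using hgen
  choose G' R l l' θ hG' hR hB using hB
  let e : ∀ j, (F.obj j).unop ⟶ c.pt.unop := fun j => (c.π.app j).unop
  have he : ∀ {j j' : J} (φ : j ⟶ j'), (F.map φ).unop ≫ e j = e j' := fun φ =>
    Quiver.Hom.op_inj (c.w φ)
  constructor
  · refine ⟨Σ j, G j, fun p => e p.1 (η p.1 p.2), mk_sigma_lt hJ' hG, ?_⟩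
    -- The subalgebra generated by the images of all generators receives every leg, so the universal
    -- property splits its inclusion.
    obtain ⟨C, i, hi, hC⟩ := exists_closure fun p : Σ j, G j => e p.1 (η p.1 p.2)
    have hfac : ∀ j, ∃ k : (F.obj j).unop ⟶ C, k ≫ i = e j := fun j =>
      exists_factor_of_injective i hi (e j) fun x => (hC _).2 (by
        obtain ⟨t, rfl⟩ := hη j x
        exact ⟨t.rename fun g => ⟨j, g⟩, by rw [KBoolTerm.eval_rename, KBoolTerm.map_eval]⟩)
    choose k hk using hfac
    obtain ⟨r, hr⟩ := exists_lift hc k fun j j' φ => KBoolAlg.hom_ext fun x => hi (by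
      simp only [← KBoolAlg.comp_apply, Category.assoc, hk, he])
    have hri : r ≫ i = 𝟙 _ := unop_hom_ext hc fun j => by
      rw [← Category.assoc, hr, hk]
      exact (Category.comp_id (e j)).symm
    intro x
    refine (hC x).1 ⟨r x, ?_⟩
    rw [← KBoolAlg.comp_apply, hri, id_apply]
  · choose t ht using fun j x => (hB j).isGenBy (m j x)
    let ρ : ∀ j, G' j → Σ j, G' j := fun j g => ⟨j, g⟩
    -- `Q` glues the `B j` along generators only: for each arrow, every generator at its target is
    -- identified with its image at the source. This keeps the number of relations below `κ`.
    obtain ⟨Q, ζ, hQ, -⟩ := exists_isPresentedBy (κ := κ) (G := Σ j, G' j)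
      (R := (Σ j, R j) ⊕ Σ φ : Arrow J, G φ.right)
      (Sum.elim (fun p => (l p.1 p.2).rename (ρ _))
        fun p => (t _ ((F.map p.1.hom).unop (η p.1.right p.2))).rename (ρ p.1.left))
      (Sum.elim (fun p => (l' p.1 p.2).rename (ρ _))
        fun p => (t _ (η p.1.right p.2)).rename (ρ p.1.right))
    have hrel := fun p => hQ.relations (Sum.inl p)
    have hcomp := fun p => hQ.relations (Sum.inr p)
    simp only [Sum.elim_inl, Sum.elim_inr, KBoolTerm.eval_rename] at hrel hcomp
    choose b hb using fun j => (hB j).exists_hom (B := Q) (fun g => ζ (ρ j g)) fun x => hrel ⟨j, x⟩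
    have hbt : ∀ j x, (t j x).eval Q (fun g => ζ (ρ j g)) = b j (m j x) := fun j x => by
      rw [← ht, KBoolTerm.map_eval]
      simp only [hb]
    obtain ⟨k, hk⟩ := exists_lift hc (fun j => m j ≫ b j) fun j j' φ => (hη j').hom_ext fun g => by
      have := hcomp ⟨Arrow.mk φ, g⟩
      exact (hbt _ _).symm.trans (this.trans (hbt _ _))
    refine ⟨Q, k, ⟨_, _, _, _, ζ, mk_sigma_lt hJ' hG', mk_sum_lt (mk_sigma_lt hJ' hR)
      (mk_sigma_lt hJ fun φ => hG _), hQ⟩, ?_⟩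
    -- `Q` maps to an amalgam of the `B j` over the colimit, and the injection `v` into the amalgam
    -- factors through `k`.
    obtain ⟨D, d, v, hdv, hv⟩ :=
      exists_injective_amalgam (fun j => (F.obj j).unop) B c.pt.unop m e hm
    have hdm : ∀ j x, d j (m j x) = v (e j x) := fun j x => by
      rw [← KBoolAlg.comp_apply, hdv, KBoolAlg.comp_apply]
    have htd : ∀ j x, (t j x).eval D (fun g => d j (θ j g)) = v (e j x) := fun j x => by
      rw [← hdm, ← ht, KBoolTerm.map_eval]
    obtain ⟨q, hq⟩ := hQ.exists_hom (fun p => d p.1 (θ p.1 p.2)) (by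
      rintro (p | ⟨φ, g⟩)
      · simp only [Sum.elim_inl, KBoolTerm.eval_rename, ρ]
        have := congrArg (d p.1) ((hB p.1).relations p.2)
        rwa [KBoolTerm.map_eval, KBoolTerm.map_eval] at this
      · simp only [Sum.elim_inr, KBoolTerm.eval_rename, ρ]
        rw [htd, htd, ← he φ.hom, KBoolAlg.comp_apply])
    have hkq : k ≫ q = v := unop_hom_ext hc fun j => by
      rw [← Category.assoc, hk]
      refine KBoolAlg.hom_ext fun x => ?_
      rw [KBoolAlg.comp_apply, KBoolAlg.comp_apply, ← hbt, KBoolTerm.map_eval]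
      simp only [hq, ρ]
      exact htd j x
    intro x y hxy
    apply hv
    rw [← hkq, KBoolAlg.comp_apply, KBoolAlg.comp_apply, hxy]

/-- The two legs of the amalgam of the dual with itself coincide, and the interpolant between `x`
and `x` is a preimage of `x`. -/
theorem surjective_of_mono {X Y : KBorLoc κ} (f : X ⟶ Y) [Mono f] :
    Function.Surjective f.unop := by
  obtain ⟨D, u, v, huv, h⟩ := exists_binary_amalgam f.unop f.unop
  have : u = v := Quiver.Hom.op_inj ((cancel_mono f).1 (Quiver.Hom.unop_inj huv))
  subst this
  intro x
  obtain ⟨a, ha, ha'⟩ := h x x le_rfl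
  exact ⟨a, le_antisymm ha' ha⟩

/-- A morphism with injective dual coequalizes its kernel pair. -/
theorem exists_desc {X Y Z W : KBorLoc κ} {f : X ⟶ Y} (hf : Function.Injective f.unop)
    {g₁ g₂ : Z ⟶ X} (h : IsPullback g₁ g₂ f f) (k : X ⟶ W) (hk : g₁ ≫ k = g₂ ≫ k) :
    ∃ l : Y ⟶ W, f ≫ l = k := by
  -- The amalgam is a test object for the kernel pair, so `u` and `v` agree on the values of `k`; by
  -- interpolation these values lie in the range of the dual of `f`.
  obtain ⟨D, u, v, huv, hD⟩ := exists_binary_amalgam f.unop f.unop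
  have huv' : u.op ≫ f = v.op ≫ f := Quiver.Hom.unop_inj huv
  have hkuv : u.op ≫ k = v.op ≫ k := by
    have h₁ := h.lift_fst _ _ huv'
    have h₂ := h.lift_snd _ _ huv'
    rw [← h₁, Category.assoc, hk, ← Category.assoc, h₂]
  obtain ⟨l, hl⟩ := exists_factor_of_injective f.unop hf k.unop fun x => by
    have : u (k.unop x) = v (k.unop x) := congrArg (fun r => r.unop x) hkuv
    obtain ⟨a, ha, ha'⟩ := hD _ _ this.ge
    exact ⟨a, le_antisymm ha' ha⟩
  exact ⟨l.op, Quiver.Hom.unop_inj hl⟩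

/-- The free algebra on one generator. -/
theorem exists_free_one (κ : Cardinal.{u}) [Fact κ.IsRegular] :
    ∃ (A : KBoolAlg κ) (a : A), A.IsKPresented ∧
      (∀ (B : KBoolAlg κ) (b : B), ∃ h : A ⟶ B, h a = b) ∧
        ∀ (B : KBoolAlg κ) (h h' : A ⟶ B), h a = h' a → h = h' := by
  obtain ⟨A, η, hA, hη⟩ := exists_isPresentedBy (κ := κ) (G := PUnit.{u + 1}) (R := PEmpty.{u + 1})
    PEmpty.elim PEmpty.elim
  refine ⟨A, η ⟨⟩, ⟨_, _, _, _, η, mk_punit_lt, mk_pempty_lt, hA⟩, fun B b => ?_,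
    fun B h h' e => hη.hom_ext fun _ => e⟩
  obtain ⟨h, hh⟩ := hA.exists_hom (fun _ => b) fun r => r.elim
  exact ⟨h, hh ⟨⟩⟩

/-- Elements are homomorphisms from the free algebra on one generator, which is `κ`-presented.
Testing only standard targets makes the criterion usable inside the analytic subcategory. -/
theorem injective_of_standard_cancel {X Y : KBorLoc κ} (f : X ⟶ Y)
    (h : ∀ (W : KBorLoc κ) (k l : Y ⟶ W), W.IsStandard → f ≫ k = f ≫ l → k = l) :
    Function.Injective f.unop := by
  obtain ⟨A, a, hA, hu, he⟩ := exists_free_one κ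
  intro x y hxy
  obtain ⟨k, rfl⟩ := hu _ x
  obtain ⟨l, rfl⟩ := hu _ y
  have := h (op A) k.op l.op hA (Quiver.Hom.unop_inj (he _ _ _ hxy))
  rw [Quiver.Hom.op_inj this]

theorem hasPullbacks : HasPullbacks (KBorLoc κ) := by
  have := hasLimitsOfShape (κ := κ) (ULiftHom.{u} (ULift.{u} WalkingCospan))
  exact hasLimitsOfShape_of_equivalence (ULiftHomULiftCategory.equiv WalkingCospan).symm

theorem isRegularEpi_of_injective {X Y : KBorLoc κ} (f : X ⟶ Y)
    (hf : Function.Injective f.unop) : IsRegularEpi f := by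
  have := hasPullbacks (κ := κ)
  have := epi_of_injective f hf
  have hex : ∀ s : Cofork (pullback.fst f f) (pullback.snd f f), ∃ l, f ≫ l = s.π := fun s =>
    exists_desc hf (IsPullback.of_hasPullback f f) s.π s.condition
  choose l hl using hex
  exact ⟨⟨⟨_, _, _, pullback.condition, Cofork.IsColimit.mk _ l hl fun s m hm =>
    (cancel_epi f).1 (hm.trans (hl s).symm)⟩⟩⟩

theorem injective_of_epi {X Y : KBorLoc κ} (f : X ⟶ Y) [Epi f] : Function.Injective f.unop :=
  injective_of_standard_cancel f fun _ _ _ _ => (cancel_epi f).1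

theorem isImageFactorization_iff {X Y Z : KBorLoc κ} {f : X ⟶ Y} {e : X ⟶ Z} {m : Z ⟶ Y} :
    IsImageFactorization f e m ↔
      e ≫ m = f ∧ Function.Injective e.unop ∧ Function.Surjective m.unop := by
  refine ⟨fun h => ⟨h.fac, ?_, ?_⟩, fun h => ⟨h.1, isRegularEpi_of_injective e h.2.1,
    mono_of_surjective m h.2.2⟩⟩
  · have := h.isRegularEpi
    have : Epi e := inferInstance
    exact injective_of_epi e
  · have := h.mono
    exact surjective_of_mono m

/-- A choice of generators is a surjection from a free algebra, that is, a monomorphism into a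
standard locale; an embedding in a `κ`-presented algebra is a regular epimorphism from one. -/
theorem isAnalytic_iff {X : KBorLoc κ} : IsAnalytic κ X ↔ KBoolAlg.IsAnalytic X.unop := by
  constructor
  · rintro ⟨X₀, X₁, p, e, m, h₀, h₁, h⟩
    obtain ⟨-, he, hm⟩ := isImageFactorization_iff.1 h
    exact KBoolAlg.IsAnalytic.of_surjective_injective (KBoolAlg.IsKPresented.isAnalytic h₁)
      (KBoolAlg.IsKPresented.isAnalytic h₀) m.unop hm e.unop he
  · rintro ⟨⟨G, η, hG, hη⟩, B, m, hB, hm⟩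
    obtain ⟨A, ζ, hA, -⟩ := exists_isPresentedBy (κ := κ) (G := G) (R := PEmpty.{u + 1})
      PEmpty.elim PEmpty.elim
    obtain ⟨e, he⟩ := hA.exists_hom η fun r => r.elim
    refine ⟨op B, op A, m.op ≫ e.op, m.op, e.op, hB, ⟨_, _, _, _, ζ, hG, mk_pempty_lt, hA⟩,
      isImageFactorization_iff.2 ⟨rfl, hm, ?_⟩⟩
    exact surjective_of_isGenBy e hη fun g => ⟨_, he g⟩

theorem exists_isImageFactorization {X Y : KBorLoc κ} (f : X ⟶ Y) :
    ∃ (Z : KBorLoc κ) (e : X ⟶ Z) (m : Z ⟶ Y), IsImageFactorization f e m := by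
  obtain ⟨C, e, m, h, he, hm⟩ := exists_image f.unop
  exact ⟨op C, m.op, e.op, isImageFactorization_iff.2 ⟨Quiver.Hom.unop_inj h, hm, he⟩⟩

theorem IsAnalytic.of_isImageFactorization {X Y Z : KBorLoc κ} {f : X ⟶ Y} {e : X ⟶ Z}
    {m : Z ⟶ Y} (hX : IsAnalytic κ X) (hY : IsAnalytic κ Y) (h : IsImageFactorization f e m) :
    IsAnalytic κ Z := by
  obtain ⟨-, he, hm⟩ := isImageFactorization_iff.1 h
  exact isAnalytic_iff.2 (KBoolAlg.IsAnalytic.of_surjective_injective (isAnalytic_iff.1 hY)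
    (isAnalytic_iff.1 hX) m.unop hm e.unop he)

theorem isClosedUnderLimitsOfShape (J : Type u) [SmallCategory J]
    (hJ : Cardinal.mk (Arrow J) < κ) : (IsAnalytic κ).IsClosedUnderLimitsOfShape J where
  limitsOfShape_le := by
    rintro X ⟨h⟩
    exact isAnalytic_iff.2 (isAnalytic_of_isLimit hJ h.isLimit fun j =>
      isAnalytic_iff.1 (h.prop_diag_obj j))

/-- The comparison homomorphism of a cocone over a discrete diagram. -/
def toPi {I : Type u} {F : Discrete I ⥤ KBorLoc κ} (c : Cocone F) :
    c.pt.unop ⟶ KBoolAlg.pi fun i => (F.obj ⟨i⟩).unop :=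
  piLift fun i => (c.ι.app ⟨i⟩).unop

theorem nonempty_isColimit_of_bijective {I : Type u} {F : Discrete I ⥤ KBorLoc κ} (c : Cocone F)
    (hc : Function.Bijective (toPi c)) : Nonempty (IsColimit c) := by
  have := isIso_of_bijective _ hc
  have hfac : ∀ i, inv (toPi c) ≫ (c.ι.app ⟨i⟩).unop = piProj _ i := fun i => by
    rw [IsIso.inv_comp_eq]
    rfl
  refine ⟨{ desc := fun s => (toPi s ≫ inv (toPi c)).op, fac := ?_, uniq := ?_ }⟩
  · rintro s ⟨i⟩
    refine Quiver.Hom.unop_inj ?_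
    change (toPi s ≫ inv (toPi c)) ≫ (c.ι.app ⟨i⟩).unop = (s.ι.app ⟨i⟩).unop
    rw [Category.assoc, hfac]
    rfl
  · intro s m hm
    refine Quiver.Hom.unop_inj ?_
    change m.unop = toPi s ≫ inv (toPi c)
    rw [IsIso.eq_comp_inv]
    refine KBoolAlg.hom_ext fun x => funext fun i => ?_
    exact congrArg (fun k => k.unop x) (hm ⟨i⟩)

/-- The cocone of the product algebra. -/
def piCocone {I : Type u} (F : Discrete I ⥤ KBorLoc κ) : Cocone F where
  pt := op (KBoolAlg.pi fun i => (F.obj ⟨i⟩).unop)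
  ι := Discrete.natTrans fun i => (piProj (fun i => (F.obj ⟨i⟩).unop) i.as).op

theorem nonempty_isColimit_piCocone {I : Type u} (F : Discrete I ⥤ KBorLoc κ) :
    Nonempty (IsColimit (piCocone F)) :=
  nonempty_isColimit_of_bijective _ Function.bijective_id

theorem bijective_of_isColimit {I : Type u} {F : Discrete I ⥤ KBorLoc κ} {c : Cocone F}
    (hc : IsColimit c) : Function.Bijective (toPi c) := by
  obtain ⟨h⟩ := nonempty_isColimit_piCocone F
  let e := hc.coconePointUniqueUpToIso h
  have he : toPi c = e.inv.unop := KBoolAlg.hom_ext fun x => funext fun i => by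
    have := hc.comp_coconePointUniqueUpToIso_inv h ⟨i⟩
    exact (congrArg (fun k => k.unop x) this).symm
  rw [he]
  refine Function.bijective_iff_has_inverse.2 ⟨e.hom.unop, fun x => ?_, fun x => ?_⟩
  · exact congrArg (fun k => k.unop x) e.hom_inv_id
  · exact congrArg (fun k => k.unop x) e.inv_hom_id

theorem hasColimitsOfShape_discrete (I : Type u) : HasColimitsOfShape (Discrete I) (KBorLoc κ) where
  has_colimit F := ⟨⟨⟨_, (nonempty_isColimit_piCocone F).some⟩⟩⟩

theorem isClosedUnderColimitsOfShape_discrete (I : Type u) (hI : Cardinal.mk I < κ) :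
    (IsAnalytic κ).IsClosedUnderColimitsOfShape (Discrete I) where
  colimitsOfShape_le := by
    rintro X ⟨h⟩
    have hpi := KBoolAlg.IsAnalytic.pi hI (A := fun i => (h.diag.obj ⟨i⟩).unop) fun i =>
      isAnalytic_iff.1 (h.prop_diag_obj ⟨i⟩)
    have hb := bijective_of_isColimit h.isColimit
    have := isIso_of_bijective _ hb
    refine isAnalytic_iff.2 (hpi.of_surjective_injective hpi (inv (toPi (Cocone.mk _ h.ι)))
      (fun x => ⟨toPi (Cocone.mk _ h.ι) x, ?_⟩) (toPi (Cocone.mk _ h.ι)) hb.1)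
    rw [← KBoolAlg.comp_apply, IsIso.hom_inv_id]
    rfl

end KBorLoc

/-! ### Pullbacks and universality of coproducts -/

namespace KBorLoc

variable {κ : Cardinal.{u}}

theorem exists_pullback_lift {X Y Z W : KBorLoc κ} {f : X ⟶ Z} {g : Y ⟶ Z} {p : W ⟶ X} {q : W ⟶ Y}
    (h : IsPullback p q f g) {D : KBoolAlg κ} {a : X.unop ⟶ D} {b : Y.unop ⟶ D}
    (hab : f.unop ≫ a = g.unop ≫ b) :
    ∃ k : W.unop ⟶ D, p.unop ≫ k = a ∧ q.unop ≫ k = b := by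
  have w : a.op ≫ f = b.op ≫ g := Quiver.Hom.unop_inj hab
  exact ⟨(h.lift _ _ w).unop, Quiver.Hom.op_inj (h.lift_fst _ _ w),
    Quiver.Hom.op_inj (h.lift_snd _ _ w)⟩

variable [Fact κ.IsRegular]

/-- The dual of a pullback of an epimorphism is injective. -/
theorem injective_of_isPullback {X Y Z W : KBorLoc κ} {f : X ⟶ Z} {g : Y ⟶ Z} {p : W ⟶ X}
    {q : W ⟶ Y} (h : IsPullback p q f g) (hf : Function.Injective f.unop) :
    Function.Injective q.unop := by
  obtain ⟨D, u, v, huv, hv⟩ := exists_injective_amalgam (I := PUnit.{u + 1})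
    (fun _ => Z.unop) (fun _ => X.unop) Y.unop (fun _ => f.unop) (fun _ => g.unop) fun _ => hf
  obtain ⟨k, -, hk⟩ := exists_pullback_lift h (huv ⟨⟩)
  intro x y hxy
  apply hv
  rw [← hk, KBoolAlg.comp_apply, KBoolAlg.comp_apply, hxy]

/-- The kernel of the dual of a pullback of a monomorphism. -/
theorem eq_bot_iff_of_isPullback {X Y Z W : KBorLoc κ} {f : X ⟶ Z} {g : Y ⟶ Z} {p : W ⟶ X}
    {q : W ⟶ Y} (h : IsPullback p q f g) (y : Y.unop) :
    q.unop y = ⊥ ↔ ∃ z, f.unop z = ⊥ ∧ y ≤ g.unop z := by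
  constructor
  · intro hy
    obtain ⟨D, u, v, huv, hD⟩ := exists_binary_amalgam f.unop g.unop
    obtain ⟨k, -, hk⟩ := exists_pullback_lift h huv
    obtain ⟨z, hz, hz'⟩ := hD y ⊥ (by rw [← hk, KBoolAlg.comp_apply, hy, map_bot, map_bot])
    exact ⟨z, le_bot_iff.1 hz', hz⟩
  · rintro ⟨z, hz, hy⟩
    have := congrArg (fun k => k.unop z) h.w
    change p.unop (f.unop z) = q.unop (g.unop z) at this
    rw [hz, map_bot] at this
    exact le_bot_iff.1 ((OrderHomClass.mono q.unop hy).trans this.ge)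

open Classical in
/-- The summands of a coproduct are given by a partition of unity. -/
theorem exists_partition {I : Type u} {F : Discrete I ⥤ KBorLoc κ} {c : Cocone F}
    (hc : IsColimit c) : ∃ d : I → c.pt.unop, (∀ i, (c.ι.app ⟨i⟩).unop (d i) = ⊤) ∧
      (∀ i j, i ≠ j → (c.ι.app ⟨j⟩).unop (d i) = ⊥) ∧
      (∀ x y : c.pt.unop, (∀ i, (c.ι.app ⟨i⟩).unop x = (c.ι.app ⟨i⟩).unop y) → x = y) ∧
      ∀ i, Function.Surjective (c.ι.app ⟨i⟩).unop := by
  have hb := bijective_of_isColimit hc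
  choose d hd using fun i => hb.2 fun j => if i = j then ⊤ else ⊥
  refine ⟨d, fun i => (congrFun (hd i) i).trans (if_pos rfl),
    fun i j hij => (congrFun (hd i) j).trans (if_neg hij), fun x y h => hb.1 (funext h),
    fun i y => ?_⟩
  obtain ⟨x, hx⟩ := hb.2 (Function.update ⊥ i y)
  exact ⟨x, (congrFun hx i).trans (Function.update_self _ _ _)⟩

/-- The dual of `f` carries the partition of unity of `c` to one on the other cocone point, and the
pulled-back injections are dual to the quotients by its pieces. -/
theorem isUniversalColimit {I : Type u} (hI : Cardinal.mk I < κ) {F : Discrete I ⥤ KBorLoc κ}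
    {c : Cocone F} (hc : IsColimit c) : IsUniversalColimit c := by
  intro F' c' α f _ _ H
  obtain ⟨d, hd₁, hd₀, hext, hsurj⟩ := exists_partition hc
  refine nonempty_isColimit_of_bijective c' (bijective_piLift hI _ (fun i => ?_)
    (fun i => f.unop (d i)) (fun i x => ?_) (fun i j hij => ?_) ?_)
  · have := mono_of_surjective _ (hsurj i)
    have : Mono (c'.ι.app ⟨i⟩) := ⟨fun a b hab => (H ⟨i⟩).hom_ext hab ((cancel_mono (c.ι.app ⟨i⟩)).1 (by
      rw [Category.assoc, Category.assoc, ← (H ⟨i⟩).w, ← Category.assoc, hab, Category.assoc]))⟩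
    exact surjective_of_mono _
  · rw [eq_bot_iff_of_isPullback (H ⟨i⟩).flip]
    constructor
    · rintro ⟨z, hz, hx⟩
      -- `z` vanishes only on summand `i`; cutting it down by `d i` makes it vanish on all summands.
      have hz' : z ⊓ d i = ⊥ := hext _ _ fun j => by
        rw [map_inf, map_bot]
        by_cases hij : i = j
        · subst hij
          rw [hz, bot_inf_eq]
        · rw [hd₀ i j hij, inf_bot_eq]
      rw [← le_bot_iff, ← map_bot f.unop, ← hz', map_inf]
      exact inf_le_inf_right _ hx
    · intro hx
      refine ⟨(d i)ᶜ, by rw [map_compl', hd₁, compl_top], ?_⟩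
      rw [map_compl', le_compl_iff_disjoint_right, disjoint_iff]
      exact hx
  · have : d i ⊓ d j = ⊥ := hext _ _ fun k => by
      rw [map_inf, map_bot]
      by_cases hik : i = k
      · rw [hd₀ j k (hik ▸ hij.symm), inf_bot_eq]
      · rw [hd₀ i k hik, bot_inf_eq]
    rw [← map_inf, this, map_bot]
  · have : IsLUB (Set.range d) ⊤ := ⟨fun _ _ => le_top, fun y hy => top_le_iff.2 (hext _ _ fun i => by
      rw [map_top, ← top_le_iff, ← hd₁ i]
      exact OrderHomClass.mono (c.ι.app ⟨i⟩).unop (hy ⟨i, rfl⟩))⟩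
    have := isLUB_range_map f.unop hI this
    rwa [map_top] at this

theorem mk_arrow_lt {J : Type u} [SmallCategory J] (hJ : Cardinal.mk J < κ)
    (h : ∀ i j : J, Cardinal.mk (i ⟶ j) < κ) : Cardinal.mk (Arrow J) < κ := by
  refine (Cardinal.mk_le_of_injective
    (f := fun φ : Arrow J => (⟨φ.left, φ.right, φ.hom⟩ : Σ i j : J, (i ⟶ j))) ?_).trans_lt
    (mk_sigma_lt hJ fun i => mk_sigma_lt hJ fun j => h i j)
  rintro ⟨i, j, f⟩ ⟨i', j', f'⟩ h
  simp only [Sigma.mk.injEq] at h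
  obtain ⟨rfl, h⟩ := h
  obtain ⟨rfl, h⟩ := Sigma.mk.inj (eq_of_heq h)
  cases h
  rfl

theorem mk_arrow_lt_of_isThin {J : Type u} [SmallCategory J] [Quiver.IsThin J]
    (hJ : Cardinal.mk J < κ) : Cardinal.mk (Arrow J) < κ :=
  mk_arrow_lt hJ fun _ _ => (Cardinal.lt_aleph0_of_finite _).trans_le
    (Fact.out (p := κ.IsRegular)).aleph0_le

end KBorLoc

/-! ### The category of analytic locales: regularity and extensivity -/

open KBorLoc

namespace AnalyticKBorLoc

variable {κ : Cardinal.{u}} [Fact κ.IsRegular]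

theorem isAnalytic_unop (X : AnalyticKBorLoc κ) : KBoolAlg.IsAnalytic X.obj.unop :=
  isAnalytic_iff.1 X.property

theorem hasLimitsOfShape {J : Type u} [SmallCategory J] (hJ : Cardinal.mk (Arrow J) < κ) :
    HasLimitsOfShape J (AnalyticKBorLoc κ) := by
  have := KBorLoc.hasLimitsOfShape (κ := κ) J
  have := isClosedUnderLimitsOfShape J hJ
  infer_instance

theorem preservesLimitsOfShape {J : Type u} [SmallCategory J] (hJ : Cardinal.mk (Arrow J) < κ) :
    PreservesLimitsOfShape J (KBorLoc.IsAnalytic κ).ι := by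
  have := KBorLoc.hasLimitsOfShape (κ := κ) J
  have := isClosedUnderLimitsOfShape J hJ
  infer_instance

theorem mk_arrow_lt_of_finCategory {J : Type u} [SmallCategory J] [FinCategory J] :
    Cardinal.mk (Arrow J) < κ := by
  have h := (Fact.out (p := κ.IsRegular)).aleph0_le
  exact mk_arrow_lt ((Cardinal.lt_aleph0_of_finite _).trans_le h)
    fun _ _ => (Cardinal.lt_aleph0_of_finite _).trans_le h

instance : HasFiniteLimits (AnalyticKBorLoc κ) :=
  hasFiniteLimits_of_hasFiniteLimits_of_size.{u} _ fun _ _ _ =>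
    hasLimitsOfShape mk_arrow_lt_of_finCategory

instance : PreservesFiniteLimits (KBorLoc.IsAnalytic κ).ι :=
  preservesFiniteLimits_of_preservesFiniteLimitsOfSize.{u} _ fun _ _ _ =>
    preservesLimitsOfShape mk_arrow_lt_of_finCategory

theorem hasColimitsOfShape_discrete {I : Type u} (hI : Cardinal.mk I < κ) :
    HasColimitsOfShape (Discrete I) (AnalyticKBorLoc κ) := by
  have := KBorLoc.hasColimitsOfShape_discrete (κ := κ) I
  have := isClosedUnderColimitsOfShape_discrete (κ := κ) I hI
  infer_instance

theorem preservesColimitsOfShape_discrete {I : Type u} (hI : Cardinal.mk I < κ) :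
    PreservesColimitsOfShape (Discrete I) (KBorLoc.IsAnalytic κ).ι := by
  have := KBorLoc.hasColimitsOfShape_discrete (κ := κ) I
  have := isClosedUnderColimitsOfShape_discrete (κ := κ) I hI
  infer_instance

variable {X Y Z W : AnalyticKBorLoc κ}

theorem mono_iff (f : X ⟶ Y) : Mono f ↔ Function.Surjective f.hom.unop := by
  constructor
  · intro hf
    have : Mono f.hom := inferInstanceAs (Mono ((KBorLoc.IsAnalytic κ).ι.map f))
    exact surjective_of_mono f.hom
  · intro hf
    have : Mono ((KBorLoc.IsAnalytic κ).ι.map f) := mono_of_surjective f.hom hf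
    exact (KBorLoc.IsAnalytic κ).ι.mono_of_mono_map this

/-- Standard locales are analytic, so an epimorphism of the subcategory can be cancelled against all
the targets needed to detect injectivity. -/
theorem epi_iff (f : X ⟶ Y) : Epi f ↔ Function.Injective f.hom.unop := by
  constructor
  · intro hf
    refine injective_of_standard_cancel f.hom fun W k l hW hkl => ?_
    let W' : AnalyticKBorLoc κ := ⟨W, isAnalytic_iff.2 (KBoolAlg.IsKPresented.isAnalytic hW)⟩
    have : (ObjectProperty.homMk k : Y ⟶ W') = ObjectProperty.homMk l :=
      (cancel_epi f).1 (ObjectProperty.hom_ext _ hkl)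
    exact congrArg (fun r => r.hom) this
  · intro hf
    have : Epi ((KBorLoc.IsAnalytic κ).ι.map f) := epi_of_injective f.hom hf
    exact (KBorLoc.IsAnalytic κ).ι.epi_of_epi_map this

theorem isPullback_hom {f : X ⟶ Z} {g : Y ⟶ Z} {p : W ⟶ X} {q : W ⟶ Y} (h : IsPullback p q f g) :
    IsPullback p.hom q.hom f.hom g.hom :=
  h.map (KBorLoc.IsAnalytic κ).ι

theorem nonempty_isColimit_of_isKernelPair {f : X ⟶ Y} (hf : Function.Injective f.hom.unop)
    {g₁ g₂ : Z ⟶ X} (h : IsKernelPair f g₁ g₂) : Nonempty (IsColimit (Cofork.ofπ f h.w)) := by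
  have := (epi_iff f).2 hf
  have hex : ∀ s : Cofork g₁ g₂, ∃ l, f ≫ l = s.π := fun s => by
    obtain ⟨l, hl⟩ := exists_desc hf (isPullback_hom h) s.π.hom
      (congrArg (fun r => r.hom) s.condition)
    exact ⟨ObjectProperty.homMk l, ObjectProperty.hom_ext _ hl⟩
  choose l hl using hex
  exact ⟨Cofork.IsColimit.mk _ l hl fun s m hm => (cancel_epi f).1 (hm.trans (hl s).symm)⟩

theorem isRegularEpi_iff (f : X ⟶ Y) : IsRegularEpi f ↔ Function.Injective f.hom.unop := by
  constructor
  · intro hf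
    have : Epi f := inferInstance
    exact (epi_iff f).1 this
  · intro hf
    obtain ⟨h⟩ := nonempty_isColimit_of_isKernelPair hf (IsPullback.of_hasPullback f f)
    exact ⟨⟨⟨_, _, _, _, h⟩⟩⟩

theorem exists_image (f : X ⟶ Y) : ∃ (Z : AnalyticKBorLoc κ) (e : X ⟶ Z) (m : Z ⟶ Y),
    e ≫ m = f ∧ Function.Injective e.hom.unop ∧ Mono m := by
  obtain ⟨Z, e, m, h⟩ := exists_isImageFactorization f.hom
  refine ⟨⟨Z, X.property.of_isImageFactorization Y.property h⟩, ObjectProperty.homMk e,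
    ObjectProperty.homMk m, ObjectProperty.hom_ext _ h.fac, ?_, ?_⟩
  · exact (isImageFactorization_iff.1 h).2.1
  · exact (mono_iff _).2 (isImageFactorization_iff.1 h).2.2

/-- The second factor of an image is monic, so a kernel pair of `f` is one of its first factor,
which is its coequalizer. -/
theorem regular : Regular (AnalyticKBorLoc κ) where
  hasCoequalizer_of_isKernelPair {X Y Z f g₁ g₂} h := by
    obtain ⟨E, e, m, rfl, he, hm⟩ := exists_image f
    obtain ⟨hc⟩ := nonempty_isColimit_of_isKernelPair he (IsKernelPair.cancel_right_of_mono h)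
    exact ⟨⟨⟨_, hc⟩⟩⟩
  regularEpiIsStableUnderBaseChange :=
    { of_isPullback := fun {X Y Y' S f g f' g'} sq hg =>
        (isRegularEpi_iff _).2 (injective_of_isPullback (isPullback_hom sq)
          ((isRegularEpi_iff g).1 hg)) }

/-- An object with a trivial algebra is initial. -/
theorem isInitial_of_top_eq_bot (X : AnalyticKBorLoc κ) (h : (⊤ : X.obj.unop) = ⊥) :
    Nonempty (IsInitial X) := by
  have hX : ∀ x y : X.obj.unop, x = y := fun x y =>
    (eq_bot_of_bot_eq_top h.symm x).trans (eq_bot_of_bot_eq_top h.symm y).symm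
  refine ⟨IsInitial.ofUniqueHom (fun Y => ObjectProperty.homMk (Quiver.Hom.op (homOfSup
    (fun _ => ⊥) (fun _ => hX _ _) fun I hI a s hs => ?_))) fun Y m => ?_⟩
  · exact ⟨by rintro _ ⟨i, rfl⟩; exact le_rfl, fun _ _ => bot_le⟩
  · exact ObjectProperty.hom_ext _ (Quiver.Hom.unop_inj (KBoolAlg.hom_ext fun x => hX _ _))

theorem top_eq_bot_of_isInitial {X : AnalyticKBorLoc κ} (h : IsInitial X) :
    (⊤ : X.obj.unop) = ⊥ := by
  let T : AnalyticKBorLoc κ := ⟨op (KBoolAlg.pi (κ := κ) PEmpty.elim),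
    isAnalytic_iff.2 (KBoolAlg.IsAnalytic.pi mk_pempty_lt fun i => i.elim)⟩
  let f := h.to T
  rw [← map_top f.hom.unop, ← map_bot f.hom.unop]
  exact congrArg f.hom.unop (funext fun i => i.elim)

theorem hasStrictInitialObjects : HasStrictInitialObjects (AnalyticKBorLoc κ) where
  out {X A} f hX := by
    have hA : (⊤ : A.obj.unop) = ⊥ := by
      rw [← map_top f.hom.unop, top_eq_bot_of_isInitial hX, map_bot]
    obtain ⟨hA⟩ := isInitial_of_top_eq_bot A hA
    exact ⟨hX.to A, hA.hom_ext _ _, hX.hom_ext _ _⟩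

theorem isKExtensive : IsKExtensive κ (AnalyticKBorLoc κ) where
  hasFiniteLimits := inferInstance
  hasCoproducts I hI := hasColimitsOfShape_discrete hI
  universal I hI X c hc := by
    have := preservesColimitsOfShape_discrete hI
    exact IsUniversalColimit.of_mapCocone (KBorLoc.IsAnalytic κ).ι
      (KBorLoc.isUniversalColimit hI (isColimitOfPreserves _ hc))
  disjoint I hI X := by
    have := preservesColimitsOfShape_discrete hI
    refine ⟨fun {c} hc {i j} hij s _ => ?_, fun {c} hc i => ?_⟩
    · obtain ⟨d, hd₁, hd₀, -, -⟩ :=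
        exists_partition (isColimitOfPreserves (KBorLoc.IsAnalytic κ).ι hc)
      refine isInitial_of_top_eq_bot _ ?_
      -- Along the two legs `d i` becomes both `⊤` and `⊥`, so the intersection has a trivial
      -- algebra.
      have h := congrArg (fun r => r.hom.unop (d i)) s.condition
      change s.fst.hom.unop ((c.inj i).hom.unop (d i)) =
        s.snd.hom.unop ((c.inj j).hom.unop (d i)) at h
      have h₁ : (c.inj i).hom.unop (d i) = ⊤ := hd₁ i
      have h₀ : (c.inj j).hom.unop (d i) = ⊥ := hd₀ i j hij
      rwa [h₁, h₀, map_top, map_bot] at h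
    · obtain ⟨d, -, -, -, h⟩ :=
        exists_partition (isColimitOfPreserves (KBorLoc.IsAnalytic κ).ι hc)
      exact (mono_iff _).2 (h i)
  strictInitial := hasStrictInitialObjects

end AnalyticKBorLoc

/-! ### Subobjects as ideals -/

namespace AnalyticKBorLoc

variable {κ : Cardinal.{u}} {X Y : AnalyticKBorLoc κ}

/-- The ideal of elements that vanish on a subobject. -/
def ideal (S : Subobject X) : Set X.obj.unop := {x | S.arrow.hom.unop x = ⊥}

theorem mem_ideal_mk {Z : AnalyticKBorLoc κ} (m : Z ⟶ X) [Mono m] (x : X.obj.unop) :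
    x ∈ ideal (Subobject.mk m) ↔ m.hom.unop x = ⊥ := by
  have h₁ := congrArg (fun r => r.hom.unop x) (Subobject.underlyingIso_arrow m)
  have h₂ := congrArg (fun r => r.hom.unop x) (Subobject.underlyingIso_hom_comp_eq_mk m)
  constructor
  · intro (hx : (Subobject.mk m).arrow.hom.unop x = ⊥)
    refine h₁.symm.trans ?_
    change (Subobject.underlyingIso m).inv.hom.unop ((Subobject.mk m).arrow.hom.unop x) = ⊥
    rw [hx, map_bot]
  · intro hx
    refine h₂.symm.trans ?_
    change (Subobject.underlyingIso m).hom.hom.unop (m.hom.unop x) = ⊥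
    rw [hx, map_bot]

theorem mem_ideal_of_le {S : Subobject X} {x y : X.obj.unop} (hxy : x ≤ y) (hy : y ∈ ideal S) :
    x ∈ ideal S :=
  le_bot_iff.1 ((OrderHomClass.mono S.arrow.hom.unop hxy).trans (le_of_eq hy))

theorem kSup_mem_ideal {S : Subobject X} {I : Type u} (hI : Cardinal.mk I < κ)
    {x : I → X.obj.unop} (hx : ∀ i, x i ∈ ideal S) : X.obj.unop.kSup hI x ∈ ideal S := by
  change S.arrow.hom.unop _ = ⊥
  rw [map_kSup]
  exact le_bot_iff.1 (kSup_le hI fun i => (hx i).le)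

variable [Fact κ.IsRegular]

/-- Subobjects are dual to surjections, and a homomorphism factors through a surjection exactly when
it kills the kernel. -/
theorem le_iff {S T : Subobject X} : S ≤ T ↔ ideal T ⊆ ideal S := by
  constructor
  · intro h x (hx : T.arrow.hom.unop x = ⊥)
    change S.arrow.hom.unop x = ⊥
    have := congrArg (fun r => r.hom.unop x) (Subobject.ofLE_arrow h)
    refine this.symm.trans ?_
    change (Subobject.ofLE S T h).hom.unop (T.arrow.hom.unop x) = ⊥
    rw [hx, map_bot]
  · intro h
    obtain ⟨k, hk⟩ := exists_factor_of_surjective T.arrow.hom.unop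
      ((mono_iff _).1 inferInstance) S.arrow.hom.unop h
    exact Subobject.le_of_comm (ObjectProperty.homMk k.op)
      (ObjectProperty.hom_ext _ (Quiver.Hom.unop_inj hk))

theorem mem_ideal_pullback (f : Y ⟶ X) (S : Subobject X) (y : Y.obj.unop) :
    y ∈ ideal ((Subobject.pullback f).obj S) ↔ ∃ x ∈ ideal S, y ≤ f.hom.unop x :=
  eq_bot_iff_of_isPullback (isPullback_hom (Subobject.isPullback f S)) y

/-- The subobject is the image of the coproduct of the `A i` in `X`; analyticity of this coproduct
needs `I` to be small. -/
theorem exists_ideal_eq_iInter {I : Type u} (hI : Cardinal.mk I < κ) (A : I → Subobject X) :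
    ∃ S : Subobject X, ∀ x, x ∈ ideal S ↔ ∀ i, x ∈ ideal (A i) := by
  let B : I → KBoolAlg κ := fun i => ((A i : AnalyticKBorLoc κ)).obj.unop
  obtain ⟨C, e, m, hem, he, hm⟩ := KBoolAlg.exists_image
    (piLift (A := B) fun i => (A i).arrow.hom.unop)
  have hC : KBoolAlg.IsAnalytic C := (isAnalytic_unop X).of_surjective_injective
    (KBoolAlg.IsAnalytic.pi hI fun i => isAnalytic_unop _) e he m hm
  let Z : AnalyticKBorLoc κ := ⟨op C, isAnalytic_iff.2 hC⟩
  let f : Z ⟶ X := ObjectProperty.homMk e.op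
  have : Mono f := (mono_iff f).2 he
  refine ⟨Subobject.mk f, fun x => ?_⟩
  rw [mem_ideal_mk]
  change e x = ⊥ ↔ _
  have h : m (e x) = fun i => (A i).arrow.hom.unop x := by
    rw [← KBoolAlg.comp_apply, hem]
    rfl
  constructor
  · intro hx i
    rw [hx, map_bot] at h
    exact (congrFun h i).symm
  · intro hx
    refine (injective_iff m).1 hm _ (h.trans (funext hx))

/-- The subobject is the wide pullback of the `A i` over `X`. An element vanishing there vanishes in
the amalgam of the `A i` over `X`, and interpolation produces the bound. -/
theorem exists_ideal_eq_iSup {I : Type u} (hI : Cardinal.mk I < κ) (A : I → Subobject X) :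
    ∃ S : Subobject X, ∀ x, x ∈ ideal S ↔
      ∃ n : I → X.obj.unop, (∀ i, n i ∈ ideal (A i)) ∧ x ≤ X.obj.unop.kSup hI n := by
  have hJ : Cardinal.mk (WidePullbackShape I) < κ := by
    change Cardinal.mk (Option I) < κ
    rw [Cardinal.mk_option]
    exact Cardinal.add_lt_of_lt (Fact.out (p := κ.IsRegular)).aleph0_le hI
      ((Cardinal.one_lt_aleph0).trans_le (Fact.out (p := κ.IsRegular)).aleph0_le)
  have := hasLimitsOfShape (κ := κ) (mk_arrow_lt_of_isThin hJ)
  have := preservesLimitsOfShape (κ := κ) (mk_arrow_lt_of_isThin hJ)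
  let F : WidePullbackShape I ⥤ AnalyticKBorLoc κ :=
    WidePullbackShape.wideCospan X (fun i => (A i : AnalyticKBorLoc κ)) fun i => (A i).arrow
  let c := limit.cone F
  have hc : IsLimit c := limit.isLimit F
  let b : c.pt ⟶ X := c.π.app none
  let p : ∀ i, c.pt ⟶ (A i : AnalyticKBorLoc κ) := fun i => c.π.app (some i)
  have hb : ∀ i, p i ≫ (A i).arrow = b := fun i => c.w (WidePullbackShape.Hom.term i)
  have : Mono b := ⟨fun g h e => hc.hom_ext fun j => by
    cases j with
    | none => exact e
    | some i =>
      refine (cancel_mono (A i).arrow).1 (?_ : (g ≫ p i) ≫ _ = (h ≫ p i) ≫ _)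
      rwa [Category.assoc, Category.assoc, hb]⟩
  refine ⟨Subobject.mk b, fun x => ?_⟩
  constructor
  · intro hx
    rw [mem_ideal_mk] at hx
    obtain ⟨D, u, v, huv, hD⟩ := exists_amalgam (fun _ : I => X.obj.unop)
      (fun i => ((A i : AnalyticKBorLoc κ)).obj.unop) X.obj.unop
      (fun i => (A i).arrow.hom.unop) fun i => 𝟙 _
    let h : ∀ j, ((F ⋙ (KBorLoc.IsAnalytic κ).ι).obj j).unop ⟶ D := fun j =>
      match j with
      | none => v
      | some i => u i
    obtain ⟨k, hk⟩ := exists_lift (isLimitOfPreserves (KBorLoc.IsAnalytic κ).ι hc) h (by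
      rintro j j' (_ | i)
      · exact (congrArg (· ≫ h j) (congrArg Quiver.Hom.unop ((F ⋙ _).map_id j))).trans
          (Category.id_comp _)
      · exact (huv i).trans (Category.id_comp v))
    have hv : v x = ⊥ := by
      have : b.hom.unop ≫ k = v := hk none
      rw [← this, KBoolAlg.comp_apply, hx, map_bot]
    obtain ⟨a, ha, hz⟩ := hD x (fun _ => ⊤) fun d hd _ => le_bot_iff.1 (hd.trans hv.le)
    -- `a i` restricts to `⊤` on `A i`, so its complement lies in the ideal; what `x` has outside
    -- all these complements lies below every `a i` and hence is zero.
    refine ⟨fun i => (a i)ᶜ, fun i => ?_, ?_⟩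
    · change (A i).arrow.hom.unop (a i)ᶜ = ⊥
      rw [map_compl', top_le_iff.1 (ha i), compl_top]
    · rw [← sdiff_eq_bot_iff]
      refine hz _ sdiff_le fun i => ?_
      rw [sdiff_eq]
      refine inf_le_right.trans ?_
      exact compl_le_iff_compl_le.1 (le_kSup hI (fun i => (a i)ᶜ) i)
  · rintro ⟨n, hn, hx⟩
    refine mem_ideal_of_le hx (kSup_mem_ideal hI fun i => ?_)
    rw [mem_ideal_mk, ← hb i]
    change (p i).hom.unop ((A i).arrow.hom.unop (n i)) = ⊥
    rw [hn i, map_bot]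

/-- A subobject with the intersection ideal is a join because inclusion of ideals reverses the
order; the converse follows from its existence and the uniqueness of joins. -/
theorem isLUB_iff {I : Type u} (hI : Cardinal.mk I < κ) {A : I → Subobject X} {S : Subobject X} :
    IsLUB (Set.range A) S ↔ ∀ x, x ∈ ideal S ↔ ∀ i, x ∈ ideal (A i) := by
  have key : ∀ S : Subobject X, (∀ x, x ∈ ideal S ↔ ∀ i, x ∈ ideal (A i)) →
      IsLUB (Set.range A) S := fun S hS => by
    refine ⟨?_, fun T hT => le_iff.2 fun x hx => (hS x).2 fun i => le_iff.1 (hT ⟨i, rfl⟩) hx⟩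
    rintro _ ⟨i, rfl⟩
    exact le_iff.2 fun x hx => (hS x).1 hx i
  refine ⟨fun h => ?_, key S⟩
  obtain ⟨T, hT⟩ := exists_ideal_eq_iInter hI A
  rwa [h.unique (key T hT)]

theorem isGLB_iff {I : Type u} (hI : Cardinal.mk I < κ) {A : I → Subobject X} {S : Subobject X} :
    IsGLB (Set.range A) S ↔ ∀ x, x ∈ ideal S ↔
      ∃ n : I → X.obj.unop, (∀ i, n i ∈ ideal (A i)) ∧ x ≤ X.obj.unop.kSup hI n := by
  classical
  have key : ∀ S : Subobject X, (∀ x, x ∈ ideal S ↔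
      ∃ n : I → X.obj.unop, (∀ i, n i ∈ ideal (A i)) ∧ x ≤ X.obj.unop.kSup hI n) →
      IsGLB (Set.range A) S := fun S hS => by
    refine ⟨?_, fun T hT => le_iff.2 fun x hx => ?_⟩
    · rintro _ ⟨i, rfl⟩
      refine le_iff.2 fun x hx => (hS x).2 ⟨Function.update (fun _ => ⊥) i x, fun j => ?_, ?_⟩
      · by_cases hij : j = i
        · subst hij
          rwa [Function.update_self]
        · rw [Function.update_of_ne hij]
          exact map_bot _
      · refine le_trans ?_ (le_kSup hI _ i)
        rw [Function.update_self]
    · obtain ⟨n, hn, hxn⟩ := (hS x).1 hx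
      exact mem_ideal_of_le hxn (kSup_mem_ideal hI fun i => le_iff.1 (hT ⟨i, rfl⟩) (hn i))
  refine ⟨fun h => ?_, key S⟩
  obtain ⟨T, hT⟩ := exists_ideal_eq_iSup hI A
  rwa [h.unique (key T hT)]

theorem mem_ideal_of_isLUB_pair {S T U : Subobject X} (h : IsLUB {S, T} U) (x : X.obj.unop) :
    x ∈ ideal U ↔ x ∈ ideal S ∧ x ∈ ideal T := by
  rw [← range_ulift_bool.{u}, isLUB_iff mk_ulift_bool_lt] at h
  rw [h]
  exact ⟨fun h => ⟨h ⟨true⟩, h ⟨false⟩⟩, fun h => by rintro ⟨_ | _⟩; exacts [h.2, h.1]⟩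

theorem mem_ideal_of_isGLB_pair {S T U : Subobject X} (h : IsGLB {S, T} U) (x : X.obj.unop) :
    x ∈ ideal U ↔ ∃ s ∈ ideal S, ∃ t ∈ ideal T, x ≤ s ⊔ t := by
  rw [← range_ulift_bool.{u}, isGLB_iff mk_ulift_bool_lt] at h
  rw [h]
  constructor
  · rintro ⟨n, hn, hx⟩
    refine ⟨n ⟨true⟩, hn ⟨true⟩, n ⟨false⟩, hn ⟨false⟩, hx.trans (kSup_le _ ?_)⟩
    rintro ⟨_ | _⟩
    exacts [le_sup_right, le_sup_left]
  · rintro ⟨s, hs, t, ht, hx⟩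
    refine ⟨fun b => cond b.down s t, ?_, hx.trans (sup_le ?_ ?_)⟩
    · rintro ⟨_ | _⟩
      exacts [ht, hs]
    · exact le_kSup mk_ulift_bool_lt (fun b : ULift.{u} Bool => cond b.down s t) ⟨true⟩
    · exact le_kSup mk_ulift_bool_lt (fun b : ULift.{u} Bool => cond b.down s t) ⟨false⟩

theorem isKFrame (X : AnalyticKBorLoc κ) : IsKFrame κ κ (Subobject X) where
  exists_inf I hI b := by
    obtain ⟨S, hS⟩ := exists_ideal_eq_iSup hI b
    exact ⟨S, (isGLB_iff hI).2 hS⟩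
  exists_sup I hI b := by
    obtain ⟨S, hS⟩ := exists_ideal_eq_iInter hI b
    exact ⟨S, (isLUB_iff hI).2 hS⟩
  sup_inf_distrib I hI a b c s t hs ht hc := by
    rw [isGLB_iff hI] at hs ⊢
    intro x
    have hc' := fun i => mem_ideal_of_isLUB_pair (hc i)
    rw [mem_ideal_of_isLUB_pair ht, hs]
    constructor
    · rintro ⟨hxa, n, hn, hx⟩
      -- Cutting `n i` down by `x` puts it in the ideal of `a` too, and by distributivity these
      -- pieces still cover `x`.
      refine ⟨fun i => x ⊓ n i, fun i => (hc' i _).2 ⟨mem_ideal_of_le inf_le_left hxa,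
        mem_ideal_of_le inf_le_right (hn i)⟩, ?_⟩
      rw [← inf_of_le_left hx]
      refine (inf_kSup_le hI fun i => ?_)
      rw [inf_of_le_left hx]
      exact le_kSup hI (fun i => x ⊓ n i) i
    · rintro ⟨n, hn, hx⟩
      exact ⟨mem_ideal_of_le hx (kSup_mem_ideal hI fun i => ((hc' i _).1 (hn i)).1), n,
        fun i => ((hc' i _).1 (hn i)).2, hx⟩
  inf_sup_distrib I hI a b c s t hs ht hc := by
    rw [isLUB_iff hI] at hs ⊢
    intro x
    have hc' := fun i => mem_ideal_of_isGLB_pair (hc i)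
    simp only [hc']
    rw [mem_ideal_of_isGLB_pair ht]
    constructor
    · rintro ⟨p, hp, n, hn, hx⟩ i
      exact ⟨p, hp, n, (hs n).1 hn i, hx⟩
    · intro h
      choose p hp n hn hx using h
      -- The splittings `x ≤ p i ⊔ n i` depend on `i`. The join of the `p i` stays in the ideal of
      -- `a`, and the remainder of `x` lies below every `n i`.
      refine ⟨X.obj.unop.kSup hI p, kSup_mem_ideal hI hp, x \ X.obj.unop.kSup hI p,
        (hs _).2 fun i => mem_ideal_of_le ?_ (hn i), le_sup_sdiff⟩
      rw [sdiff_le_iff]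
      exact (hx i).trans (sup_le_sup_right (le_kSup hI p i) _)

/-- Joins are stable because separate bounds `x i` for `y` can be replaced by their meet, which lies
in every ideal and is preserved by the dual of `f`. -/
theorem isKCoherent : IsKCoherent κ (AnalyticKBorLoc κ) where
  toRegular := regular
  exists_join X I hI A := by
    obtain ⟨S, hS⟩ := exists_ideal_eq_iInter hI A
    refine ⟨S, (isLUB_iff hI).2 hS, fun Y f => (isLUB_iff hI).2 fun y => ?_⟩
    simp only [mem_ideal_pullback]
    constructor
    · rintro ⟨x, hx, hy⟩ i
      exact ⟨x, (hS x).1 hx i, hy⟩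
    · intro h
      choose x hx hy using h
      refine ⟨X.obj.unop.kInf hI x, (hS _).2 fun i => mem_ideal_of_le (kInf_le hI x i) (hx i), ?_⟩
      rw [map_kInf]
      exact le_kInf hI hy

/-! ### Codirected limits and products of epimorphisms -/

theorem injective_of_codirected {I : Type u} [PartialOrder I] [IsDirectedOrder I]
    (hI : Cardinal.mk I < κ) (F : Iᵒᵖ ⥤ AnalyticKBorLoc κ)
    (hF : ∀ ⦃i j : Iᵒᵖ⦄ (f : i ⟶ j), Function.Injective (F.map f).hom.unop) {c : Cone F}
    (hc : IsLimit c) (i : Iᵒᵖ) : Function.Injective (c.π.app i).hom.unop := by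
  have hI' : Cardinal.mk Iᵒᵖ < κ := by rwa [Cardinal.mk_congr (equivToOpposite (α := I)).symm]
  have := preservesLimitsOfShape (κ := κ) (mk_arrow_lt_of_isThin hI')
  -- The injections `u` into `D` factor through the legs into the algebra of the limit, so those
  -- legs are injective.
  obtain ⟨D, u, hu, hinj⟩ := exists_directed_amalgam (F ⋙ (KBorLoc.IsAnalytic κ).ι).unop
    fun i j f => hF f.op
  obtain ⟨k, hk⟩ := exists_lift (isLimitOfPreserves (KBorLoc.IsAnalytic κ).ι hc)
    (fun j => u j.unop) fun j j' φ => hu φ.unop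
  intro x y hxy
  have h : (c.π.app i).hom.unop ≫ k = u i.unop := hk i
  apply hinj i.unop
  rw [← h, KBoolAlg.comp_apply, KBoolAlg.comp_apply, hxy]

/-- The algebras of the `X i` are amalgamated over that of the product of the `Y i`; the injection
of the latter into the amalgam factors through the dual of `g`. -/
theorem injective_of_products {I : Type u} (hI : Cardinal.mk I < κ)
    (X Y : I → AnalyticKBorLoc κ) (f : ∀ i, X i ⟶ Y i)
    (hf : ∀ i, Function.Injective (f i).hom.unop) {c : Fan X} {d : Fan Y} (hc : IsLimit c)
    (hd : IsLimit d) (g : c.pt ⟶ d.pt) (hg : ∀ i, g ≫ d.proj i = c.proj i ≫ f i) :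
    Function.Injective g.hom.unop := by
  have hI' : Cardinal.mk (Discrete I) < κ := by rwa [Cardinal.mk_congr discreteEquiv]
  have := preservesLimitsOfShape (κ := κ) (mk_arrow_lt_of_isThin hI')
  obtain ⟨D, u, v, huv, hv⟩ := exists_injective_amalgam (fun i => (Y i).obj.unop)
    (fun i => (X i).obj.unop) d.pt.obj.unop (fun i => (f i).hom.unop)
    (fun i => (d.proj i).hom.unop) hf
  obtain ⟨k, hk⟩ := exists_lift (isLimitOfPreserves (KBorLoc.IsAnalytic κ).ι hc)
    (fun j => u j.as) (by
      rintro ⟨j⟩ ⟨j'⟩ φ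
      obtain rfl : j = j' := Discrete.eq_of_hom φ
      obtain rfl : φ = 𝟙 _ := Subsingleton.elim _ _
      rw [CategoryTheory.Functor.map_id]
      exact Category.id_comp _)
  have hgk : g.hom.unop ≫ k = v := by
    refine unop_hom_ext (isLimitOfPreserves (KBorLoc.IsAnalytic κ).ι hd) ?_
    rintro ⟨j⟩
    have h₁ : (c.proj j).hom.unop ≫ k = u j := hk ⟨j⟩
    have h₂ : (d.proj j).hom.unop ≫ g.hom.unop = (f j).hom.unop ≫ (c.proj j).hom.unop :=
      congrArg (fun r => r.hom.unop) (hg j)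
    change (d.proj j).hom.unop ≫ g.hom.unop ≫ k = (d.proj j).hom.unop ≫ v
    rw [← Category.assoc, h₂, Category.assoc, h₁, huv]
  intro x y hxy
  apply hv
  rw [← hgk, KBoolAlg.comp_apply, KBoolAlg.comp_apply, hxy]

theorem isStableUnderKProducts_epimorphisms :
    IsStableUnderKProducts κ (MorphismProperty.epimorphisms (AnalyticKBorLoc κ)) :=
  fun _ hI X Y f hf _ _ hc hd g hg => (epi_iff g).2
    (injective_of_products hI X Y f (fun i => (epi_iff _).1 (hf i)) hc hd g hg)

theorem isKCompletelyRegular : IsKCompletelyRegular κ (AnalyticKBorLoc κ) where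
  toRegular := regular
  hasProducts I hI := hasLimitsOfShape (mk_arrow_lt_of_isThin (J := Discrete I)
    (by rwa [Cardinal.mk_congr discreteEquiv]))
  regularEpi_products _ hI X Y f hf _ _ hc hd g hg := (isRegularEpi_iff g).2
    (injective_of_products hI X Y f (fun i => (isRegularEpi_iff _).1 (hf i)) hc hd g hg)

end AnalyticKBorLoc

open AnalyticKBorLoc

theorem mainTheorem11 (κ : Cardinal.{u}) (hκ : κ.IsRegular) :
    -- closure under limits, coproducts and images
    (∀ (J : Type u) [SmallCategory J], Cardinal.mk (Arrow J) < κ →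
      HasLimitsOfShape J (KBorLoc κ) ∧ HasLimitsOfShape J (AnalyticKBorLoc κ) ∧
        (KBorLoc.IsAnalytic κ).IsClosedUnderLimitsOfShape J) ∧
    (∀ I : Type u, Cardinal.mk I < κ →
      HasColimitsOfShape (Discrete I) (KBorLoc κ) ∧
        (KBorLoc.IsAnalytic κ).IsClosedUnderColimitsOfShape (Discrete I)) ∧
    (∀ (X Y : KBorLoc κ) (f : X ⟶ Y), KBorLoc.IsAnalytic κ X → KBorLoc.IsAnalytic κ Y →
      (∃ (Z : KBorLoc κ) (e : X ⟶ Z) (m : Z ⟶ Y), IsImageFactorization f e m) ∧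
        ∀ (Z : KBorLoc κ) (e : X ⟶ Z) (m : Z ⟶ Y), IsImageFactorization f e m →
          KBorLoc.IsAnalytic κ Z) ∧
    -- extensivity and coherence
    IsKExtensive κ (AnalyticKBorLoc κ) ∧
    IsKCoherent κ (AnalyticKBorLoc κ) ∧
    -- codirected limits and products of (regular) epimorphisms
    IsStableUnderKCodirectedLimits κ (MorphismProperty.epimorphisms (AnalyticKBorLoc κ)) ∧
    IsStableUnderKCodirectedLimits κ (MorphismProperty.regularEpi (AnalyticKBorLoc κ)) ∧
    IsStableUnderKProducts κ (MorphismProperty.epimorphisms (AnalyticKBorLoc κ)) ∧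
    IsKCompletelyRegular κ (AnalyticKBorLoc κ) ∧
    -- subobject lattices
    (∀ X : AnalyticKBorLoc κ, IsKFrame κ κ (Subobject X)) ∧
    -- epimorphisms are regular
    IsRegularEpiCategory (AnalyticKBorLoc κ) := by
  have : Fact κ.IsRegular := ⟨hκ⟩
  refine ⟨fun J _ hJ => ⟨KBorLoc.hasLimitsOfShape J, AnalyticKBorLoc.hasLimitsOfShape hJ,
      isClosedUnderLimitsOfShape J hJ⟩,
    fun I hI => ⟨KBorLoc.hasColimitsOfShape_discrete I,
      isClosedUnderColimitsOfShape_discrete I hI⟩,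
    fun X Y f hX hY => ⟨exists_isImageFactorization f,
      fun Z e m h => hX.of_isImageFactorization hY h⟩,
    isKExtensive, isKCoherent, ?_, ?_, isStableUnderKProducts_epimorphisms,
    isKCompletelyRegular, isKFrame, ⟨fun f _ => ?_⟩⟩
  · intro I _ _ hI F hF c hc i
    exact (epi_iff _).2 (injective_of_codirected hI F (fun i j f => (epi_iff _).1 (hF f)) hc i)
  · intro I _ _ hI F hF c hc i
    exact (isRegularEpi_iff _).2
      (injective_of_codirected hI F (fun i j f => (isRegularEpi_iff _).1 (hF f)) hc i)
  · exact (isRegularEpi_iff f).2 ((epi_iff f).1 inferInstance)
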